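/- Let $k\ge 1$ be an integer. Let $F$ be the direct sum over $(m,n)\in\mathbb Z^2$ of the bosonic Fock modules with lowest-level states $|m,n\rangle$, on which the modes $\alpha_j,\bar\alpha_j$ ($j\in\mathbb Z$) act with $[\alpha_i,\alpha_j]=[\bar\alpha_i,\bar\alpha_j]=i\,\delta_{i+j,0}$, $[\alpha_i,\bar\alpha_j]=0$, $\alpha_j|m,n\rangle=\bar\alpha_j|m,n\rangle=0$ for $j>0$, and $$\alpha_0|m,n\rangle=\tfrac{km+n}{\sqrt{2k}}|m,n\rangle,\qquad \bar\alpha_0|m,n\rangle=\tfrac{km-n}{\sqrt{2k}}|m,n\rangle$$ (compactification radius $R=1/\sqrt{2k}$). Let $L_0=\frac12\sum_{j\in\mathbb Z}:\alpha_{-j}\alpha_j:$ and $\bar L_0=\frac12\sum_{j\in\mathbb Z}:\bar\alpha_{-j}\bar\alpha_j:$. The modes $J^\pm_N$ ($N\in\mathbb Z$) of the currents $J^\pm(z)=\sum_N J^\pm_N z^{-N-k}=:e^{\pm i\sqrt{2k}\,\phi(z)}:$ are defined by $$J^\pm(z)=e^{\pm\sqrt{2k}\sum_{j>0}\alpha_{-j}z^{j}/j}\;e^{\mp\sqrt{2k}\sum_{j>0}\alpha_{j}z^{-j}/j}\;T^{\pm1}\,z^{\pm\sqrt{2k}\,\alpha_0},$$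 where $T$ commutes with all $\alpha_j,\bar\alpha_j$, $j\ne0$, and $T|m,n\rangle=|m+1,n+k\rangle$. The modes $\bar J^\pm_N$ are defined in the same way from the $\bar\alpha_j$, with $\bar T|m,n\rangle=|m+1,n-k\rangle$. Let $$S=\{\alpha_i\alpha_j,\; J^+_N+J^-_N,\; \alpha_j(J^+_N-J^-_N),\; \bar\alpha_i\bar\alpha_j,\; \bar J^+_N+\bar J^-_N,\; \bar\alpha_j(\bar J^+_N-\bar J^-_N)\;:\; i,j,N\in\mathbb Z\}.$$ For integers $s,s'\ge 0$ and signs $\epsilon,\delta\in\{+1,-1\}$ put $$g^{\epsilon\delta}_{s,s'}=|s+s'+1,k(s-s')\rangle+\epsilon\delta\,|{-(s+s'+1)},-k(s-s')\rangle+\delta\,|s-s',k(s+s'+1)\rangle+\epsilon\,|{-(s-s')},-k(s+s'+1)\rangle ,$$ and for $a,b\in\{0,1\}$ let $F_{a,b}(g)$ be the span of all $\alpha_{-n_1}\cdots\alpha_{-n_i}\bar\alpha_{-n'_1}\cdots\bar\alpha_{-n'_j}\,g$ with $n_1,\dots,n_i,n'_1,\dots,n'_j\ge1$, $i\equiv a$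 and $j\equiv b \pmod 2$. Define $$H^{Uv}_{s+s'+1,k(s-s')}=F_{0,0}(g^{++}_{s,s'})+F_{1,1}(g^{--}_{s,s'})+F_{1,0}(g^{-+}_{s,s'})+F_{0,1}(g^{+-}_{s,s'}),$$ $$H^{Ub}_{s+s'+1,k(s-s')}=F_{1,1}(g^{++}_{s,s'})+F_{0,0}(g^{--}_{s,s'})+F_{0,1}(g^{-+}_{s,s'})+F_{1,0}(g^{+-}_{s,s'}),$$ $$H^v_{k/4}=\sum_{s,s'\ge0}H^{Uv}_{s+s'+1,k(s-s')},\qquad H^b_{k/4}=\sum_{s,s'\ge0}H^{Ub}_{s+s'+1,k(s-s')}.$$ Then the space generated from $|1,0\rangle+|{-1},0\rangle+(|0,k\rangle+|0,-k\rangle)$ by the algebra of operators generated by $S$ is exactly $H^v_{k/4}$, and the space generated from $|1,0\rangle+|{-1},0\rangle-(|0,k\rangle+|0,-k\rangle)$ is exactly $H^b_{k/4}$. On both modules $L_0$ and $\bar L_0$ are simultaneously diagonalizable with real eigenvalues and finite joint multiplicities, and for all real $q$ with $0<q<1$ $$\mathrm{Tr}_{H^v_{k/4}}\bigl(q^{L_0-1/24}q^{\bar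 L_0-1/24}\bigr)=\mathrm{Tr}_{H^b_{k/4}}\bigl(q^{L_0-1/24}q^{\bar L_0-1/24}\bigr)=\chi^*_k(q)^2,$$ where $$\chi^*_k(q)=\sum_{n=0}^{\infty}\frac{q^{k(n+1/2)^2}}{\eta(q)},\qquad \eta(q)=q^{1/24}\prod_{n=1}^\infty(1-q^n).$$ -/

import Mathlib

open scoped BigOperators

noncomputable section

namespace Z2Orbifold

/-! ## Locally finite sums of operators -/

/-- The operator `v ↦ ∑ i, f i v`, for a family of operators of which only finitely many are
nonzero on any given vector. -/
def locSum {ι V : Type*} [AddCommGroup V] [Module ℂ V] (f : ι → Module.End ℂ V)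
    (hf : ∀ v, (Function.support fun i => f i v).Finite) : Module.End ℂ V where
  toFun v := ∑ᶠ i, f i v
  map_add' v w := by
    simp only [map_add]
    exact finsum_add_distrib (hf v) (hf w)
  map_smul' c v := by
    simp only [map_smul, RingHom.id_apply]
    exact (smul_finsum' c (hf v)).symm

/-! ## The Fock spaces -/

/-- The two chiral halves: `left` carries the modes `α_n`, `right` the modes `ᾱ_n`. -/
inductive Chirality
  | left
  | right
  deriving DecidableEq

/-- `+1` for the left-movers and `-1` for the right-movers. -/
def Chirality.sign : Chirality → ℤ
  | .left => 1
  | .right => -1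

/-- Polynomials in the creation operators: the variable `(left, n)` is `α_{-n}` and the variable
`(right, n)` is `ᾱ_{-n}`, for `n ≥ 1`. -/
abbrev Osc : Type := MvPolynomial (Chirality × ℕ+) ℂ

/-- The creation operator with mode number `-n`, on the oscillator space. -/
def cre (c : Chirality) (n : ℕ+) : Module.End ℂ Osc :=
  LinearMap.mulLeft ℂ (MvPolynomial.X (c, n))

/-- The annihilation operator with mode number `n`, on the oscillator space. -/
def ann (c : Chirality) (n : ℕ+) : Module.End ℂ Osc :=
  ((n : ℕ) : ℂ) • (MvPolynomial.pderiv (R := ℂ) (c, n)).toLinearMap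

/-- The direct sum over all `(m, n) ∈ ℤ²` of the Fock modules built on `|m, n⟩`. -/
abbrev Fock : Type := (ℤ × ℤ) →₀ Osc

/-- The lowest-level state `|m, n⟩`, with momentum number `m` and winding number `n`. -/
def ket (m n : ℤ) : Fock := Finsupp.single (m, n) 1

/-- The integer charge: `k m + n` for the left-movers, `k m - n` for the right-movers. -/
def charge (k : ℕ) (c : Chirality) (p : ℤ × ℤ) : ℤ := k * p.1 + c.sign * p.2

/-- The modes `α_n` (left) and `ᾱ_n` (right), `n ∈ ℤ`, for the radius `R = 1 / √(2k)`. The zero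
mode has the eigenvalue `m / (2 R) ± n R = (k m ± n) / √(2k)` on the Fock module of `|m, n⟩`. -/
def mode (k : ℕ) (c : Chirality) : ℤ → Module.End ℂ Fock
  | .ofNat 0 => Finsupp.lsum ℂ fun p =>
      ((charge k c p : ℂ) / (Real.sqrt (2 * k) : ℂ)) • Finsupp.lsingle p
  | .ofNat (j + 1) => Finsupp.mapRange.linearMap (ann c j.succPNat)
  | .negSucc j => Finsupp.mapRange.linearMap (cre c j.succPNat)

/-! ## The Virasoro zero modes -/

theorem mode_ofNat_succ_single (k : ℕ) (c : Chirality) (j : ℕ) (p : ℤ × ℤ) (P : Osc) :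
    mode k c (Int.ofNat (j + 1)) (Finsupp.single p P) =
      Finsupp.single p (ann c j.succPNat P) := by
  simp [mode]

theorem finite_support_mode (k : ℕ) (c : Chirality) (v : Fock) :
    {n : ℤ | mode k c |n| v ≠ 0}.Finite := by
  induction v using Finsupp.induction_linear with
  | zero => simp
  | add v w hv hw =>
    refine (hv.union hw).subset fun n hn => ?_
    simp only [Set.mem_ofPred_eq, map_add] at hn
    by_contra h
    simp only [Set.mem_union, Set.mem_ofPred_eq, not_or, not_not] at h
    exact hn (by rw [h.1, h.2, add_zero])
  | single p P =>
    have key : ∀ j : ℕ, (c, j.succPNat) ∉ P.vars →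
        mode k c (Int.ofNat (j + 1)) (Finsupp.single p P) = 0 := by
      intro j hj
      rw [mode_ofNat_succ_single]
      simp [ann, MvPolynomial.pderiv_eq_zero_of_notMem_vars hj]
    let B : ℕ := P.vars.sup fun x => (x.2 : ℕ)
    refine (Set.finite_Icc (-(B : ℤ)) B).subset fun n hn => ?_
    rw [Set.mem_Icc, ← abs_le]
    by_contra hlt
    push Not at hlt
    obtain ⟨j, hj⟩ : ∃ j : ℕ, |n| = Int.ofNat (j + 1) := by
      refine ⟨(|n| - 1).toNat, ?_⟩
      simp only [Int.ofNat_eq_natCast]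
      push_cast
      omega
    refine hn ?_
    rw [hj]
    refine key j fun hmem => ?_
    have h1 := Finset.le_sup (f := fun x : Chirality × ℕ+ => (x.2 : ℕ)) hmem
    simp only [Nat.succPNat_coe] at h1
    rw [hj] at hlt
    simp only [Int.ofNat_eq_natCast] at hlt
    have h2 : (j.succ : ℕ) ≤ B := h1
    omega

/-- `L₀ = ½ ∑_{n ∈ ℤ} :α_{-n} α_n:` (left) and its right-moving counterpart. Normal ordering puts
the mode with the larger index to the right, so `:α_{-n} α_n: = α_{-|n|} α_{|n|}`. -/
def vir0 (k : ℕ) (c : Chirality) : Module.End ℂ Fock :=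
  (1 / 2 : ℂ) • locSum (fun n : ℤ => mode k c (-|n|) * mode k c |n|) fun v =>
    (finite_support_mode k c v).subset fun n hn h0 => hn (by
      simp only [Module.End.mul_apply, h0, map_zero])

/-! ## The currents -/

/-- The Schur polynomials, `exp (∑_{n ≥ 1} t_n z^n) = ∑_N z^N S_N(t_1, …, t_N)`, for commuting
elements `t_n` of an algebra: `S_N` is the sum of `∏_i t_i^{n_i} / n_i!` over all `(n_i)` with
`∑ i n_i = N`, that is, over the partitions of `N` with `n_i` parts equal to `i`. -/
def schur {A : Type*} [Ring A] [Algebra ℂ A] (t : ℕ+ → A) (N : ℕ) : A :=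
  ∑ p : N.Partition, ((List.range N).map fun i =>
    ((Nat.factorial (p.parts.count (i + 1)) : ℂ)⁻¹) •
      t i.succPNat ^ p.parts.count (i + 1)).prod

/-- Schur polynomials with an integer index: zero for a negative index. -/
def schurInt {A : Type*} [Ring A] [Algebra ℂ A] (t : ℕ+ → A) : ℤ → A
  | .ofNat N => schur t N
  | .negSucc _ => 0

/-- `z^i`-coefficient of `exp (e √(2k) ∑_{n > 0} α_{-n} z^n / n)`. -/
def creExp (k : ℕ) (c : Chirality) (e : ℤˣ) : ℤ → Module.End ℂ Osc :=
  schurInt fun n => (((e : ℤ) : ℂ) * (Real.sqrt (2 * k) : ℂ) / ((n : ℕ) : ℂ)) • cre c n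

/-- `z^{-j}`-coefficient of `exp (-e √(2k) ∑_{n > 0} α_n z^{-n} / n)`. -/
def annExp (k : ℕ) (c : Chirality) (e : ℤˣ) : ℕ → Module.End ℂ Osc :=
  schur fun n => (-(((e : ℤ) : ℂ) * (Real.sqrt (2 * k) : ℂ)) / ((n : ℕ) : ℂ)) • ann c n

/-- The level of a monomial: the sum of its mode numbers of chirality `c`. -/
def level (c : Chirality) (d : (Chirality × ℕ+) →₀ ℕ) : ℤ :=
  d.sum fun x r => if x.1 = c then (r : ℤ) * ((x.2 : ℕ) : ℤ) else 0

theorem level_nonneg (c : Chirality) (d : (Chirality × ℕ+) →₀ ℕ) : 0 ≤ level c d := by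
  refine Finset.sum_nonneg fun x _ => ?_
  dsimp only
  split_ifs <;> positivity

theorem level_add (c : Chirality) (d d' : (Chirality × ℕ+) →₀ ℕ) :
    level c (d + d') = level c d + level c d' := by
  refine Finsupp.sum_add_index' (fun x => by simp) fun x r r' => ?_
  split_ifs
  · push_cast; ring
  · simp

/-- Polynomials all of whose monomials have level at most `D`. -/
def levelLE (c : Chirality) (D : ℤ) : Submodule ℂ Osc :=
  Submodule.span ℂ {P | ∃ d, level c d ≤ D ∧ P = MvPolynomial.monomial d 1}

theorem levelLE_neg (c : Chirality) {D : ℤ} (hD : D < 0) : levelLE c D = ⊥ := by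
  rw [levelLE, Submodule.span_eq_bot]
  rintro P ⟨d, hd, -⟩
  exact absurd (level_nonneg c d) (by omega)

theorem exists_mem_levelLE (c : Chirality) (P : Osc) : ∃ D : ℕ, P ∈ levelLE c D := by
  induction P using MvPolynomial.induction_on' with
  | monomial d a =>
    refine ⟨(level c d).toNat, ?_⟩
    have h : MvPolynomial.monomial d a = a • (MvPolynomial.monomial d 1 : Osc) := by
      simp [MvPolynomial.smul_monomial]
    rw [h]
    exact Submodule.smul_mem _ _ (Submodule.subset_span ⟨d, Int.self_le_toNat _, rfl⟩)
  | add P Q hP hQ =>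
    obtain ⟨D, hD⟩ := hP
    obtain ⟨E, hE⟩ := hQ
    have mono : ∀ {A B : ℤ}, A ≤ B → levelLE c A ≤ levelLE c B := fun hAB =>
      Submodule.span_mono fun P ⟨d, hd, h⟩ => ⟨d, hd.trans hAB, h⟩
    refine ⟨max D E, Submodule.add_mem _ (mono ?_ hD) (mono ?_ hE)⟩ <;> simp

theorem ann_mem_levelLE (c : Chirality) (n : ℕ+) {D : ℤ} {P : Osc} (hP : P ∈ levelLE c D) :
    ann c n P ∈ levelLE c (D - (n : ℕ)) := by
  induction hP using Submodule.span_induction with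
  | zero => simp
  | add P Q _ _ hP hQ => rw [map_add]; exact Submodule.add_mem _ hP hQ
  | smul a P _ hP => rw [map_smul]; exact Submodule.smul_mem _ _ hP
  | mem P hP =>
    obtain ⟨d, hd, rfl⟩ := hP
    rw [ann, LinearMap.smul_apply]
    refine Submodule.smul_mem _ _ ?_
    have h : (MvPolynomial.pderiv (R := ℂ) (c, n)).toLinearMap (MvPolynomial.monomial d 1) =
        MvPolynomial.monomial (d - Finsupp.single (c, n) 1) ((d (c, n) : ℕ) : ℂ) := by
      simp [MvPolynomial.pderiv_monomial]
    rw [h]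
    by_cases h0 : d (c, n) = 0
    · simp [h0]
    have h2 : MvPolynomial.monomial (d - Finsupp.single (c, n) 1) ((d (c, n) : ℕ) : ℂ) =
        ((d (c, n) : ℕ) : ℂ) •
          (MvPolynomial.monomial (d - Finsupp.single (c, n) 1) 1 : Osc) := by
      simp [MvPolynomial.smul_monomial]
    rw [h2]
    refine Submodule.smul_mem _ _ (Submodule.subset_span ⟨_, ?_, rfl⟩)
    have h3 : d - Finsupp.single (c, n) 1 + Finsupp.single (c, n) 1 = d :=
      tsub_add_cancel_of_le (by
        rw [Finsupp.single_le_iff]; omega)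
    have h4 := level_add c (d - Finsupp.single (c, n) 1) (Finsupp.single (c, n) 1)
    rw [h3] at h4
    have h5 : level c (Finsupp.single (c, n) 1) = ((n : ℕ) : ℤ) := by
      simp [level]
    omega

theorem annExp_mem_levelLE (k : ℕ) (c : Chirality) (e : ℤˣ) (N : ℕ) {D : ℤ} {P : Osc}
    (hP : P ∈ levelLE c D) : annExp k c e N P ∈ levelLE c (D - N) := by
  rw [annExp, schur, LinearMap.sum_apply]
  refine Submodule.sum_mem _ fun p _ => ?_
  have hpow : ∀ (a : ℂ) (n : ℕ+) (r : ℕ) (D : ℤ) (P : Osc), P ∈ levelLE c D →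
      ((a • ann c n) ^ r) P ∈ levelLE c (D - r * (n : ℕ)) := by
    intro a n r
    induction r with
    | zero => intro D P hP; simpa using hP
    | succ r ih =>
      intro D P hP
      rw [pow_succ', Module.End.mul_apply, LinearMap.smul_apply]
      refine Submodule.smul_mem _ _ ?_
      have h := ann_mem_levelLE c n (ih D P hP)
      convert h using 2
      push_cast; ring
  have hlist : ∀ (l : List ℕ) (D : ℤ) (P : Osc), P ∈ levelLE c D →
      ((l.map fun i => ((Nat.factorial (p.parts.count (i + 1)) : ℂ)⁻¹) •
        ((-(((e : ℤ) : ℂ) * (Real.sqrt (2 * k) : ℂ)) / ((i.succPNat : ℕ) : ℂ)) •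
          ann c i.succPNat) ^ p.parts.count (i + 1)).prod) P ∈
        levelLE c (D - (l.map fun i => (p.parts.count (i + 1) * (i + 1) : ℕ)).sum) := by
    intro l
    induction l with
    | nil => intro D P hP; simpa using hP
    | cons i l ih =>
      intro D P hP
      simp only [List.map_cons, List.prod_cons, List.sum_cons, Module.End.mul_apply,
        LinearMap.smul_apply]
      refine Submodule.smul_mem _ _ ?_
      have h := hpow (-(((e : ℤ) : ℂ) * (Real.sqrt (2 * k) : ℂ)) / ((i.succPNat : ℕ) : ℂ))
        i.succPNat (p.parts.count (i + 1)) _ _ (ih D P hP)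
      convert h using 2
      simp only [Nat.succPNat_coe]
      push_cast; ring
  have h := hlist (List.range N) D P hP
  convert h using 3
  have hsum : (List.map (fun i => p.parts.count (i + 1) * (i + 1)) (List.range N)).sum =
      p.parts.sum := by
    have e1 : (List.map (fun i => p.parts.count (i + 1) * (i + 1)) (List.range N)).sum =
        ∑ i ∈ Finset.range N, p.parts.count (i + 1) * (i + 1) := by
      rw [Finset.sum_range, ← List.sum_ofFn, List.ofFn_eq_map, ← List.map_coe_finRange_eq_range,
        List.map_map]
      rfl
    have e2 : p.parts.toFinset ⊆ Finset.range (N + 1) := by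
      intro x hx
      have := p.le_of_mem_parts (Multiset.mem_toFinset.1 hx)
      exact Finset.mem_range.2 (by omega)
    have e3 := Finset.sum_multiset_count_of_subset p.parts (Finset.range (N + 1)) e2
    rw [e1, e3, Finset.sum_range_succ']
    simp
  rw [hsum, p.parts_sum]

theorem finite_support_annExp (k : ℕ) (c : Chirality) (e : ℤˣ) (P : Osc) :
    {j : ℕ | annExp k c e j P ≠ 0}.Finite := by
  obtain ⟨D, hD⟩ := exists_mem_levelLE c P
  refine (Set.finite_Iic D).subset fun j hj => ?_
  rw [Set.mem_Iic]
  by_contra hlt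
  have h := annExp_mem_levelLE k c e j hD
  rw [levelLE_neg c (by omega), Submodule.mem_bot] at h
  exact hj h

/-- The `z^d`-coefficient of
`exp (e √(2k) ∑_{n > 0} α_{-n} z^n / n) exp (-e √(2k) ∑_{n > 0} α_n z^{-n} / n)`. -/
def vertexCoeff (k : ℕ) (c : Chirality) (e : ℤˣ) (d : ℤ) : Module.End ℂ Osc :=
  locSum (fun j : ℕ => creExp k c e (d + j) * annExp k c e j) fun P =>
    (finite_support_annExp k c e P).subset fun j hj h0 => hj (by
      simp only [Module.End.mul_apply, h0, map_zero])

/-- The modes of the currents: `current k c 1 N` is `J^+_N`, `current k c (-1) N` is `J^-_N`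
(with a bar for `c = right`), where `J^±(z) = :exp (± i √(2k) φ(z)): = ∑_N J^±_N z^{-N-k}`.
On the Fock module of `|m, n⟩`, where `√(2k) α_0` is the integer charge `r`, the free field gives
`J^±(z) = z^{± r} exp (± √(2k) ∑ α_{-n} z^n / n) exp (∓ √(2k) ∑ α_n z^{-n} / n)` followed by the
shift of the charge of chirality `c` by `± 2k` (the other charge is unchanged). -/
def current (k : ℕ) (c : Chirality) (e : ℤˣ) (N : ℤ) : Module.End ℂ Fock :=
  Finsupp.lsum ℂ fun p =>
    (Finsupp.lsingle (p.1 + (e : ℤ), p.2 + c.sign * (e : ℤ) * k)) ∘ₗ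
      vertexCoeff k c e (-N - k - (e : ℤ) * charge k c p)

/-! ## The symmetry algebra -/

/-- The set `S` of the operators `a_n a_m`, `J^+_N + J^-_N`, `a_n (J^+_N - J^-_N)` and of their
right-moving counterparts, for all mode numbers in `ℤ`. -/
def generators (k : ℕ) : Set (Module.End ℂ Fock) :=
  {A | ∃ c : Chirality,
    (∃ n m : ℤ, A = mode k c n * mode k c m) ∨
    (∃ N : ℤ, A = current k c 1 N + current k c (-1) N) ∨
    (∃ n N : ℤ, A = mode k c n * (current k c 1 N - current k c (-1) N))}

/-- The subspace generated from the state `v`: all `A v`, with `A` in the algebra generated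
by `S`. -/
def generated (k : ℕ) (v : Fock) : Submodule ℂ Fock :=
  (Subalgebra.toSubmodule (Algebra.adjoin ℂ (generators k))).map (LinearMap.applyₗ v)

/-! ## The modules -/

/-- The span of the states `α_{-n_1} ⋯ α_{-n_i} ᾱ_{-n'_1} ⋯ ᾱ_{-n'_j} g` with `n, n' ≥ 1`, where
`i` has the parity of `a` and `j` has the parity of `b`. -/
def strings (k : ℕ) (a b : ℕ) (g : Fock) : Submodule ℂ Fock :=
  Submodule.span ℂ {w | ∃ l r : List ℕ+, l.length ≡ a [MOD 2] ∧ r.length ≡ b [MOD 2] ∧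
    w = ((l.map fun n => mode k .left (-(n : ℤ))).prod *
      (r.map fun n => mode k .right (-(n : ℤ))).prod) g}

/-- The combination `|s+s'+1, k(s-s')⟩ + x |-(s+s'+1), -k(s-s')⟩ + y |s-s', k(s+s'+1)⟩
+ w |-(s-s'), -k(s+s'+1)⟩`. -/
def ground (k s s' : ℕ) (x y w : ℂ) : Fock :=
  ket (s + s' + 1) (k * (s - s')) + x • ket (-(s + s' + 1)) (-(k * (s - s'))) +
    y • ket (s - s') (k * (s + s' + 1)) + w • ket (-(s - s')) (-(k * (s + s' + 1)))

/-- The space `H^{Uv}_{s+s'+1, k(s-s')}`. -/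
def HUv (k s s' : ℕ) : Submodule ℂ Fock :=
  strings k 0 0 (ground k s s' 1 1 1) ⊔ strings k 1 1 (ground k s s' 1 (-1) (-1)) ⊔
    strings k 1 0 (ground k s s' (-1) 1 (-1)) ⊔ strings k 0 1 (ground k s s' (-1) (-1) 1)

/-- The space `H^{Ub}_{s+s'+1, k(s-s')}`. -/
def HUb (k s s' : ℕ) : Submodule ℂ Fock :=
  strings k 1 1 (ground k s s' 1 1 1) ⊔ strings k 0 0 (ground k s s' 1 (-1) (-1)) ⊔
    strings k 0 1 (ground k s s' (-1) 1 (-1)) ⊔ strings k 1 0 (ground k s s' (-1) (-1) 1)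

/-- The module `H^v_{k/4}`. -/
def Hv (k : ℕ) : Submodule ℂ Fock := ⨆ (s : ℕ) (s' : ℕ), HUv k s s'

/-- The module `H^b_{k/4}`. -/
def Hb (k : ℕ) : Submodule ℂ Fock := ⨆ (s : ℕ) (s' : ℕ), HUb k s s'

/-! ## Traces and characters -/

/-- The states of `H` with `L₀ = h.1` and `L̄₀ = h.2`. -/
def weightSpace (k : ℕ) (H : Submodule ℂ Fock) (h : ℝ × ℝ) : Submodule ℂ Fock :=
  H ⊓ (vir0 k .left).eigenspace (h.1 : ℂ) ⊓ (vir0 k .right).eigenspace (h.2 : ℂ)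

/-- `t` is the trace over `H` of `q^{L₀ - 1/24} q^{L̄₀ - 1/24}`: the operators `L₀` and `L̄₀` are
simultaneously diagonalizable on `H`, with real eigenvalues and finite multiplicities, and the sum
of the eigenvalues of `q^{L₀ - 1/24} q^{L̄₀ - 1/24}`, with multiplicity, converges to `t`. -/
def IsTrace (k : ℕ) (H : Submodule ℂ Fock) (q t : ℝ) : Prop :=
  H = (⨆ h : ℝ × ℝ, weightSpace k H h) ∧
  (∀ h : ℝ × ℝ, FiniteDimensional ℂ (weightSpace k H h)) ∧
  HasSum (fun h : ℝ × ℝ => (Module.finrank ℂ (weightSpace k H h) : ℝ) *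
    (q ^ (h.1 - 1 / 24) * q ^ (h.2 - 1 / 24))) t

/-- The Dedekind eta function `q^{1/24} ∏_{n ≥ 1} (1 - q^n)`. -/
def eta (q : ℝ) : ℝ := q ^ (1 / 24 : ℝ) * ∏' n : ℕ, (1 - q ^ (n + 1))

/-- The character `χ*_k(q) = ∑_{n ≥ 0} q^{k (n + 1/2)²} / η(q)`. -/
def chiStar (k : ℕ) (q : ℝ) : ℝ :=
  ∑' n : ℕ, q ^ ((k : ℝ) * ((n : ℝ) + 1 / 2) ^ 2) / eta q

end Z2Orbifold

end

open Z2Orbifold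

noncomputable section

namespace Z2Orbifold

/-! The group `Signs` of independent sign choices for the two chiralities acts on everything:
`twist` changes the signs of the oscillators and `reflect` those of the two charges. Every state in
the theorem lives over a lattice point with charges `k (2 p c + 1)`. These never vanish, so the
group acts freely on such points. For a character `χ`, `sym k χ p P` is the unnormalised projection
of `P` at the site `p` to the `χ`-isotypic part, and `symSpace k χ` is the span of these states. The
space generated from the vacuum is the one for the trivial character; the other belongs to the
product of the two sign characters.

Stability is a parity count. A mode of chirality `c` is odd under the sign of `c`, and that sign
exchanges `J^+` and `J^-`. Each element of `S` is therefore even and preserves `symSpace k χ`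
(`mode_sym`, `current_add_sym`, `current_sub_sym`). Conversely, since zero modes act by nonzero
scalars, `α_{-n} α_0` builds all oscillator states over a site. A suitable `J^+_N + J^-_N` reaches
the ground states of neighbouring sites, and `α_0²` tells the two neighbours apart. Sites in the
positive quadrant represent all orbits, so induction from the site `0` gives
`generated_eq_symSpace`. Sorting words by the parities of their lengths splits each range of `sym`
into the four pieces of `HUv` or `HUb`.

By freeness, symmetrized monomials over `p : Chirality → ℕ` form a basis, with weights `k (p c +
1/2)² + level c d` independent of `χ`. Summing over `p` gives the square of a theta series, and
summing over `d` gives the inverse square of the Euler product. Hence both traces equal `chiStar k q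
^ 2`. -/

instance : Fintype Chirality := ⟨{.left, .right}, by rintro ⟨⟩ <;> simp⟩

/-! ## Sign changes of the oscillators -/

/-- Independent choices of a sign for each chirality. -/
abbrev Signs : Type := Chirality → ℤˣ

theorem sign_mul_self (u : ℤˣ) : ((u : ℤ) : ℂ) * ((u : ℤ) : ℂ) = 1 := by
  rcases Int.units_eq_one_or u with h | h <;> simp [h]

/-- The automorphism of the oscillator space that multiplies the modes of chirality `c`
by `g c`. -/
def twist (g : Signs) : Osc →ₐ[ℂ] Osc :=
  MvPolynomial.aeval fun x => ((g x.1 : ℤ) : ℂ) • MvPolynomial.X x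

theorem twist_X (g : Signs) (x : Chirality × ℕ+) :
    twist g (MvPolynomial.X x) = ((g x.1 : ℤ) : ℂ) • MvPolynomial.X x := by
  simp [twist]

theorem twist_mul (g h : Signs) (P : Osc) : twist (g * h) P = twist g (twist h P) := by
  have : twist (g * h) = (twist g).comp (twist h) := by
    refine MvPolynomial.algHom_ext fun x => ?_
    simp [twist_X, smul_smul, mul_comm]
  rw [this, AlgHom.comp_apply]

theorem twist_one (P : Osc) : twist 1 P = P := by
  have : twist 1 = AlgHom.id ℂ Osc := by
    refine MvPolynomial.algHom_ext fun x => ?_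
    simp [twist_X]
  rw [this, AlgHom.id_apply]

theorem cre_twist (g : Signs) (c : Chirality) (n : ℕ+) (P : Osc) :
    cre c n (twist g P) = ((g c : ℤ) : ℂ) • twist g (cre c n P) := by
  simp [cre, twist_X, smul_smul, sign_mul_self]

theorem ann_twist (g : Signs) (c : Chirality) (n : ℕ+) (P : Osc) :
    ann c n (twist g P) = ((g c : ℤ) : ℂ) • twist g (ann c n P) := by
  suffices h : MvPolynomial.pderiv (c, n) (twist g P) =
      ((g c : ℤ) : ℂ) • twist g (MvPolynomial.pderiv (c, n) P) by
    simp only [ann, LinearMap.smul_apply, Derivation.coeFn_coe, map_smul] at h ⊢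
    erw [h]
    rw [smul_comm]
  induction P using MvPolynomial.induction_on with
  | C a =>
    have : twist g (MvPolynomial.C a) = MvPolynomial.C a := by simp [twist]
    simp [this]
  | add P Q hP hQ => simp only [map_add, hP, hQ, smul_add]
  | mul_X P x hP =>
    by_cases hx : x = (c, n)
    · subst hx
      simp [hP, twist_X, Derivation.leibniz, smul_smul, mul_comm]
      module
    · simp [hP, twist_X, Derivation.leibniz, MvPolynomial.pderiv_X_of_ne hx, mul_comm]
      exact smul_comm _ _ _

/-! ### Vertex operators under sign changes. -/

/-- Schur polynomials involve only sums, products and scalars, so an intertwiner of the variables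
intertwines them. This turns a sign change of the oscillators into a change of the sign `e` in the
exponentials. -/
theorem schur_semiconj {A : Type*} [Ring A] [Algebra ℂ A] {x : A} {t t' : ℕ+ → A}
    (h : ∀ n, SemiconjBy x (t n) (t' n)) (N : ℕ) : SemiconjBy x (schur t N) (schur t' N) := by
  have hl : ∀ (p : N.Partition) (l : List ℕ), SemiconjBy x
      ((l.map fun i => ((Nat.factorial (p.parts.count (i + 1)) : ℂ)⁻¹) •
        t i.succPNat ^ p.parts.count (i + 1)).prod)
      ((l.map fun i => ((Nat.factorial (p.parts.count (i + 1)) : ℂ)⁻¹) •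
        t' i.succPNat ^ p.parts.count (i + 1)).prod) := by
    intro p l
    induction l with
    | nil => simp
    | cons i l ih =>
      simp only [List.map_cons, List.prod_cons]
      refine SemiconjBy.mul_right ?_ ih
      have := ((h i.succPNat).pow_right (p.parts.count (i + 1))).eq
      rw [SemiconjBy, mul_smul_comm, smul_mul_assoc, this]
  rw [SemiconjBy, schur, schur, Finset.mul_sum, Finset.sum_mul]
  exact Finset.sum_congr rfl fun p _ => (hl p _).eq

theorem schurInt_semiconj {A : Type*} [Ring A] [Algebra ℂ A] {x : A} {t t' : ℕ+ → A}
    (h : ∀ n, SemiconjBy x (t n) (t' n)) (N : ℤ) :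
    SemiconjBy x (schurInt t N) (schurInt t' N) := by
  cases N with
  | ofNat N => exact schur_semiconj h N
  | negSucc N => simp [schurInt]

theorem creExp_twist (k : ℕ) (c : Chirality) (e : ℤˣ) (g : Signs) (N : ℤ) (P : Osc) :
    creExp k c e N (twist g P) = twist g (creExp k c (e * g c) N P) := by
  have h : SemiconjBy (twist g).toLinearMap (creExp k c (e * g c) N) (creExp k c e N) := by
    refine schurInt_semiconj (fun n => LinearMap.ext fun P => ?_) N
    simp only [Module.End.mul_apply, LinearMap.smul_apply, map_smul, AlgHom.toLinearMap_apply,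
      cre_twist, smul_smul]
    congr 1
    push_cast
    ring
  exact (LinearMap.congr_fun h P).symm

theorem annExp_twist (k : ℕ) (c : Chirality) (e : ℤˣ) (g : Signs) (N : ℕ) (P : Osc) :
    annExp k c e N (twist g P) = twist g (annExp k c (e * g c) N P) := by
  have h : SemiconjBy (twist g).toLinearMap (annExp k c (e * g c) N) (annExp k c e N) := by
    refine schur_semiconj (fun n => LinearMap.ext fun P => ?_) N
    simp only [Module.End.mul_apply, LinearMap.smul_apply, map_smul, AlgHom.toLinearMap_apply,
      ann_twist, smul_smul]
    congr 1
    push_cast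
    ring
  exact (LinearMap.congr_fun h P).symm

theorem vertexCoeff_apply (k : ℕ) (c : Chirality) (e : ℤˣ) (d : ℤ) (P : Osc) :
    vertexCoeff k c e d P = ∑ᶠ j : ℕ, creExp k c e (d + j) (annExp k c e j P) := rfl

theorem vertexCoeff_twist (k : ℕ) (c : Chirality) (e : ℤˣ) (g : Signs) (d : ℤ) (P : Osc) :
    vertexCoeff k c e d (twist g P) = twist g (vertexCoeff k c (e * g c) d P) := by
  rw [vertexCoeff_apply, vertexCoeff_apply]
  have := (twist g).toLinearMap.toAddMonoidHom.map_finsum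
    (f := fun j : ℕ => creExp k c (e * g c) (d + j) (annExp k c (e * g c) j P))
    ((finite_support_annExp k c (e * g c) P).subset fun j hj h0 => hj (by simp only [h0, map_zero]))
  refine Eq.trans ?_ this.symm
  refine finsum_congr fun j => ?_
  simp [annExp_twist, creExp_twist]

theorem schur_zero {A : Type*} [Ring A] [Algebra ℂ A] (t : ℕ+ → A) : schur t 0 = 1 := by
  simp [schur]

/-- The coefficient lowers the level by `j > 0`, and no state lies below level zero. -/
theorem annExp_one (k : ℕ) (c : Chirality) (e : ℤˣ) {j : ℕ} (hj : 0 < j) :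
    annExp k c e j 1 = 0 := by
  have h1 : (1 : Osc) ∈ levelLE c 0 :=
    Submodule.subset_span ⟨0, by simp [level], rfl⟩
  have h := annExp_mem_levelLE k c e j h1
  rwa [levelLE_neg c (by omega), Submodule.mem_bot] at h

theorem vertexCoeff_zero_one (k : ℕ) (c : Chirality) (e : ℤˣ) : vertexCoeff k c e 0 1 = 1 := by
  rw [vertexCoeff_apply, finsum_eq_single _ 0]
  · simp [annExp, creExp, schur_zero, schurInt]
  · intro j hj
    rw [annExp_one k c e (Nat.pos_of_ne_zero hj), map_zero]

/-! ## The action of the modes on one Fock module -/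

/-- The mode `α_n` or `ᾱ_n` on the Fock module of charge `r`. -/
def oscMode (k : ℕ) (c : Chirality) (r : ℤ) : ℤ → Module.End ℂ Osc
  | .ofNat 0 => ((r : ℂ) / (Real.sqrt (2 * k) : ℂ)) • 1
  | .ofNat (j + 1) => ann c j.succPNat
  | .negSucc j => cre c j.succPNat

theorem mode_single (k : ℕ) (c : Chirality) (n : ℤ) (p : ℤ × ℤ) (P : Osc) :
    mode k c n (Finsupp.single p P) = Finsupp.single p (oscMode k c (charge k c p) n P) := by
  rcases n with (_ | j) | j <;> simp [mode, oscMode]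

theorem oscMode_neg_natCast (k : ℕ) (c : Chirality) (r : ℤ) (n : ℕ+) (P : Osc) :
    oscMode k c r (-(n : ℤ)) P = MvPolynomial.X (c, n) * P := by
  obtain ⟨j, rfl⟩ : ∃ j : ℕ, n = j.succPNat := ⟨n.natPred, by simp⟩
  have : (-((j.succPNat : ℕ) : ℤ)) = Int.negSucc j := by simp [Int.negSucc_eq]
  rw [this]
  simp [oscMode, cre]

theorem oscMode_natCast (k : ℕ) (c : Chirality) (r : ℤ) (n : ℕ+) (P : Osc) :
    oscMode k c r (n : ℤ) P = ann c n P := by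
  obtain ⟨j, rfl⟩ : ∃ j : ℕ, n = j.succPNat := ⟨n.natPred, by simp⟩
  rfl

theorem oscMode_zero (k : ℕ) (c : Chirality) (r : ℤ) (P : Osc) :
    oscMode k c r 0 P = ((r : ℂ) / (Real.sqrt (2 * k) : ℂ)) • P := rfl

/-- The zero mode fits the pattern of the other modes only because the charge is reflected along
with the oscillators. -/
theorem oscMode_twist (k : ℕ) (c : Chirality) (r : ℤ) (n : ℤ) (g : Signs) (P : Osc) :
    oscMode k c (g c * r) n (twist g P) = ((g c : ℤ) : ℂ) • twist g (oscMode k c r n P) := by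
  rcases n with (_ | j) | j
  · simp [oscMode, smul_smul, mul_div_assoc]
  · exact ann_twist g c _ P
  · exact cre_twist g c _ P

/-! ## The sites with odd charges and their reflections -/

/-- The pair of numbers `(m, n)` with the charges `k (2 p c + 1)`. -/
def site (k : ℕ) (p : Chirality → ℤ) : ℤ × ℤ :=
  (p .left + p .right + 1, k * (p .left - p .right))

theorem charge_site (k : ℕ) (c : Chirality) (p : Chirality → ℤ) :
    charge k c (site k p) = k * (2 * p c + 1) := by
  cases c <;> simp [charge, site, Chirality.sign] <;> ring

theorem site_injective {k : ℕ} (hk : 0 < k) : Function.Injective (site k) := by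
  intro p q h
  funext c
  have h1 := charge_site k c p
  rw [h, charge_site] at h1
  have h2 := mul_left_cancel₀ (by exact_mod_cast hk.ne') h1
  omega

/-- The reflection of the charges with the signs `g`. -/
def reflect (g : Signs) (p : Chirality → ℤ) : Chirality → ℤ :=
  fun c => if g c = 1 then p c else -1 - p c

theorem reflect_charge (g : Signs) (p : Chirality → ℤ) (c : Chirality) :
    2 * reflect g p c + 1 = g c * (2 * p c + 1) := by
  rcases Int.units_eq_one_or (g c) with h | h <;> simp [reflect, h]
  ring

theorem reflect_mul (g h : Signs) (p : Chirality → ℤ) : reflect (g * h) p = reflect g (reflect h p) := by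
  funext c
  have h1 := reflect_charge (g * h) p c
  have h2 := reflect_charge g (reflect h p) c
  rw [reflect_charge h p c] at h2
  simp only [Pi.mul_apply, Units.val_mul] at h1
  linarith

/-- A reflection reverses the direction of a step: moving by `e` after reflecting is reflecting
after moving by `e * g c`. -/
theorem site_reflect_add (k : ℕ) (c : Chirality) (e : ℤˣ) (g : Signs) (p : Chirality → ℤ) :
    ((site k (reflect g p)).1 + (e : ℤ), (site k (reflect g p)).2 + c.sign * (e : ℤ) * k) =
      site k (reflect g (p + Pi.single c ((e * g c : ℤˣ) : ℤ))) := by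
  have h : reflect g (p + Pi.single c ((e * g c : ℤˣ) : ℤ)) = reflect g p + Pi.single c (e : ℤ) := by
    funext c'
    have h1 := reflect_charge g (p + Pi.single c ((e * g c : ℤˣ) : ℤ)) c'
    have h2 := reflect_charge g p c'
    by_cases hc : c' = c
    · subst hc
      have h3 : ((g c' : ℤˣ) : ℤ) * (g c' : ℤˣ) = 1 := by
        rcases Int.units_eq_one_or (g c') with h | h <;> simp [h]
      simp only [Pi.add_apply, Pi.single_eq_same, Units.val_mul] at h1 ⊢
      have h4 : 2 * (reflect g (p + Pi.single c' ((e : ℤ) * (g c' : ℤ))) c') =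
          2 * (reflect g p c' + e) := by
        linear_combination h1 - h2 + 2 * (e : ℤ) * h3
      omega
    · simp only [Pi.add_apply, Pi.single_eq_of_ne hc, add_zero] at h1 ⊢
      omega
  rw [h]
  cases c <;> simp [site, Chirality.sign] <;> constructor <;> ring

/-! ## Symmetrized states -/

/-- The sign of chirality `c`, as a character of the group of signs. -/
def signChar (c : Chirality) : Signs →* ℤˣ := Pi.evalMonoidHom _ c

/-- All characters have order dividing two, so two odd operators of the same chirality restore the
character. -/
theorem char_mul_self (χ ψ : Signs →* ℤˣ) : χ * ψ * ψ = χ := by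
  ext g
  simp [mul_assoc, ← sq]

/-- The state `P |p⟩`, projected to the character `χ` of the group of signs. -/
def sym (k : ℕ) (χ : Signs →* ℤˣ) (p : Chirality → ℤ) : Osc →ₗ[ℂ] Fock :=
  ∑ g : Signs, ((χ g : ℤ) : ℂ) • Finsupp.lsingle (site k (reflect g p)) ∘ₗ (twist g).toLinearMap

theorem sym_apply (k : ℕ) (χ : Signs →* ℤˣ) (p : Chirality → ℤ) (P : Osc) :
    sym k χ p P =
      ∑ g : Signs, ((χ g : ℤ) : ℂ) • Finsupp.single (site k (reflect g p)) (twist g P) := by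
  simp [sym, LinearMap.sum_apply]

/-- Reindexing the group sum shows that the sites of one orbit contribute the same states up to
sign. -/
theorem sym_reflect (k : ℕ) (χ : Signs →* ℤˣ) (h : Signs) (p : Chirality → ℤ) (P : Osc) :
    sym k χ (reflect h p) (twist h P) = ((χ h : ℤ) : ℂ) • sym k χ p P := by
  rw [sym_apply, sym_apply, Finset.smul_sum]
  refine Fintype.sum_equiv (Equiv.mulRight h) _ _ fun g => ?_
  simp only [Equiv.coe_mulRight, reflect_mul, twist_mul, map_mul, Units.val_mul, Int.cast_mul,
    smul_smul]
  rw [mul_left_comm, sign_mul_self, mul_one]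

theorem mode_sym (k : ℕ) (c : Chirality) (n : ℤ) (χ : Signs →* ℤˣ) (p : Chirality → ℤ)
    (P : Osc) : mode k c n (sym k χ p P) =
      sym k (χ * signChar c) p (oscMode k c (k * (2 * p c + 1)) n P) := by
  simp only [sym_apply, map_sum, map_smul, mode_single]
  refine Finset.sum_congr rfl fun g _ => ?_
  have h : charge k c (site k (reflect g p)) = g c * (k * (2 * p c + 1)) := by
    rw [charge_site, reflect_charge]; ring
  rw [h, oscMode_twist, ← Finsupp.smul_single, smul_smul]
  simp [signChar]

theorem current_single (k : ℕ) (c : Chirality) (e : ℤˣ) (N : ℤ) (p : ℤ × ℤ) (P : Osc) :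
    current k c e N (Finsupp.single p P) =
      Finsupp.single (p.1 + (e : ℤ), p.2 + c.sign * (e : ℤ) * k)
        (vertexCoeff k c e (-N - k - (e : ℤ) * charge k c p) P) := by
  simp [current]

/-- The vertex operator coefficient of `J^e_N` on the Fock module at the site `p`. -/
def siteCoeff (k : ℕ) (c : Chirality) (N : ℤ) (p : Chirality → ℤ) (e : ℤˣ) : Module.End ℂ Osc :=
  vertexCoeff k c e (-N - k - (e : ℤ) * (k * (2 * p c + 1)))

theorem current_single_reflect (k : ℕ) (c : Chirality) (e : ℤˣ) (N : ℤ) (g : Signs)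
    (p : Chirality → ℤ) (P : Osc) :
    current k c e N (Finsupp.single (site k (reflect g p)) (twist g P)) =
      Finsupp.single (site k (reflect g (p + Pi.single c ((e * g c : ℤˣ) : ℤ))))
        (twist g (siteCoeff k c N p (e * g c) P)) := by
  rw [current_single, site_reflect_add, charge_site, reflect_charge, vertexCoeff_twist, siteCoeff]
  congr 5
  push_cast
  ring

/-- In the summands with `g c = -1` the two currents trade places, which leaves their sum unchanged.
-/
theorem current_add_sym (k : ℕ) (c : Chirality) (N : ℤ) (χ : Signs →* ℤˣ) (p : Chirality → ℤ)
    (P : Osc) : (current k c 1 N + current k c (-1) N) (sym k χ p P) =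
      sym k χ (p + Pi.single c 1) (siteCoeff k c N p 1 P) +
        sym k χ (p + Pi.single c (-1)) (siteCoeff k c N p (-1) P) := by
  simp only [sym_apply, map_sum, map_smul, LinearMap.add_apply, current_single_reflect,
    ← Finset.sum_add_distrib]
  refine Finset.sum_congr rfl fun g _ => ?_
  rcases Int.units_eq_one_or (g c) with h | h
  · simp [h]
  · simp [h, add_comm]

/-- Here the exchange of the currents costs a sign `g c`, which is absorbed in the character. -/
theorem current_sub_sym (k : ℕ) (c : Chirality) (N : ℤ) (χ : Signs →* ℤˣ) (p : Chirality → ℤ)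
    (P : Osc) : (current k c 1 N - current k c (-1) N) (sym k χ p P) =
      sym k (χ * signChar c) (p + Pi.single c 1) (siteCoeff k c N p 1 P) -
        sym k (χ * signChar c) (p + Pi.single c (-1)) (siteCoeff k c N p (-1) P) := by
  simp only [sym_apply, map_sum, map_smul, LinearMap.sub_apply, current_single_reflect,
    ← Finset.sum_sub_distrib]
  refine Finset.sum_congr rfl fun g _ => ?_
  rcases Int.units_eq_one_or (g c) with h | h
  · simp [h, signChar, smul_sub]
  · simp [h, signChar, add_comm, sub_eq_add_neg]

/-- The span of the symmetrized states of character `χ`. -/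
def symSpace (k : ℕ) (χ : Signs →* ℤˣ) : Submodule ℂ Fock :=
  ⨆ p : Chirality → ℤ, LinearMap.range (sym k χ p)

theorem sym_mem_symSpace (k : ℕ) (χ : Signs →* ℤˣ) (p : Chirality → ℤ) (P : Osc) :
    sym k χ p P ∈ symSpace k χ :=
  Submodule.mem_iSup_of_mem (p := fun p => LinearMap.range (sym k χ p)) p ⟨P, rfl⟩

theorem symSpace_le {k : ℕ} {χ : Signs →* ℤˣ} {K : Submodule ℂ Fock}
    (h : ∀ p P, sym k χ p P ∈ K) : symSpace k χ ≤ K := by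
  refine iSup_le fun p => ?_
  rintro _ ⟨P, rfl⟩
  exact h p P

theorem symSpace_eq_iSup_nat (k : ℕ) (χ : Signs →* ℤˣ) :
    symSpace k χ = ⨆ p : Chirality → ℕ, LinearMap.range (sym k χ fun c => p c) := by
  refine le_antisymm (iSup_le fun p => ?_) (iSup_le fun p => le_iSup_of_le (fun c => p c) le_rfl)
  -- Reflecting exactly the negative coordinates moves `p` to the nonnegative representative of its
  -- orbit.
  let h : Signs := fun c => if 0 ≤ p c then 1 else -1
  have hp : reflect h p = fun c => (((reflect h p c).toNat : ℕ) : ℤ) := by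
    funext c
    by_cases hc : 0 ≤ p c
    · simp [reflect, h, hc]
    · have : (-1 : ℤˣ) ≠ 1 := by decide
      simp only [reflect, h, hc, if_false, this]
      omega
  refine le_iSup_of_le (fun c => (reflect h p c).toNat) ?_
  rw [← hp]
  rintro _ ⟨P, rfl⟩
  have h1 := sym_reflect k χ h p P
  have h2 : sym k χ p P = ((χ h : ℤ) : ℂ) • sym k χ (reflect h p) (twist h P) := by
    rw [h1, smul_smul, sign_mul_self, one_smul]
  rw [h2]
  exact Submodule.smul_mem _ _ ⟨_, rfl⟩

/-! ## Stability under the symmetry algebra, and generation -/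

theorem generated_le {k : ℕ} {v : Fock} {K : Submodule ℂ Fock} (hv : v ∈ K)
    (hK : ∀ A ∈ generators k, ∀ w ∈ K, A w ∈ K) : generated k v ≤ K := by
  rintro _ ⟨A, hA, rfl⟩
  have key : ∀ B ∈ Algebra.adjoin ℂ (generators k), ∀ w ∈ K, B w ∈ K := by
    intro B hB
    induction hB using Algebra.adjoin_induction with
    | mem B hB => exact hK B hB
    | algebraMap r => intro w hw; simpa [Algebra.algebraMap_eq_smul_one] using K.smul_mem r hw
    | add B C _ _ hB hC => intro w hw; exact K.add_mem (hB w hw) (hC w hw)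
    | mul B C _ _ hB hC => intro w hw; exact hB _ (hC w hw)
  exact key A hA v hv

theorem self_mem_generated (k : ℕ) (v : Fock) : v ∈ generated k v :=
  ⟨1, Subalgebra.one_mem _, rfl⟩

theorem generators_apply_mem_generated {k : ℕ} {v w : Fock} {A : Module.End ℂ Fock}
    (hA : A ∈ generators k) (hw : w ∈ generated k v) : A w ∈ generated k v := by
  obtain ⟨B, hB, rfl⟩ := hw
  exact ⟨A * B, Subalgebra.mul_mem _ (Algebra.subset_adjoin hA) hB, rfl⟩

theorem mode_mul_mode_sym (k : ℕ) (c : Chirality) (n m : ℤ) (χ : Signs →* ℤˣ)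
    (p : Chirality → ℤ) (P : Osc) :
    (mode k c n * mode k c m) (sym k χ p P) = sym k χ p
      (oscMode k c (k * (2 * p c + 1)) n (oscMode k c (k * (2 * p c + 1)) m P)) := by
  rw [Module.End.mul_apply, mode_sym, mode_sym, char_mul_self]

theorem generators_apply_mem_symSpace {k : ℕ} {χ : Signs →* ℤˣ} {A : Module.End ℂ Fock}
    (hA : A ∈ generators k) {w : Fock} (hw : w ∈ symSpace k χ) : A w ∈ symSpace k χ := by
  suffices h : symSpace k χ ≤ (symSpace k χ).comap A from h hw
  refine symSpace_le fun p P => ?_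
  rw [Submodule.mem_comap]
  obtain ⟨c, ⟨n, m, rfl⟩ | ⟨N, rfl⟩ | ⟨n, N, rfl⟩⟩ := hA
  · rw [mode_mul_mode_sym]
    exact sym_mem_symSpace _ _ _ _
  · rw [current_add_sym]
    exact Submodule.add_mem _ (sym_mem_symSpace _ _ _ _) (sym_mem_symSpace _ _ _ _)
  · rw [Module.End.mul_apply, current_sub_sym, map_sub, mode_sym, mode_sym, char_mul_self]
    exact Submodule.sub_mem _ (sym_mem_symSpace _ _ _ _) (sym_mem_symSpace _ _ _ _)

theorem sqrt_two_mul_ne_zero {k : ℕ} (hk : 0 < k) : (Real.sqrt (2 * k) : ℂ) ≠ 0 := by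
  have : 0 < Real.sqrt (2 * k) := Real.sqrt_pos.2 (by positivity)
  exact_mod_cast this.ne'

theorem sqrt_two_mul_mul_self (k : ℕ) :
    (Real.sqrt (2 * k) : ℂ) * (Real.sqrt (2 * k) : ℂ) = 2 * k := by
  have := Real.mul_self_sqrt (show (0 : ℝ) ≤ 2 * k by positivity)
  exact_mod_cast congrArg (fun x : ℝ => (x : ℂ)) this

theorem zero_mode_sq_sym {k : ℕ} (hk : 0 < k) (c : Chirality) (χ : Signs →* ℤˣ)
    (p : Chirality → ℤ) (P : Osc) :
    (mode k c 0 * mode k c 0) (sym k χ p P) =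
      ((k : ℂ) * (2 * (p c : ℂ) + 1) ^ 2 / 2) • sym k χ p P := by
  rw [mode_mul_mode_sym, oscMode_zero, oscMode_zero, smul_smul, map_smul]
  congr 1
  have h1 := sqrt_two_mul_ne_zero hk
  have h2 := sqrt_two_mul_mul_self k
  have h3 : (k : ℂ) ≠ 0 := by exact_mod_cast hk.ne'
  rw [div_mul_div_comm, h2]
  push_cast
  field_simp

/-- A single creation operator is not in `S`, but `α_{-n} α_0` is. The odd multiple `k (2 p c + 1)`
of `k` is nonzero, so the scalar from `α_0` can be divided out. -/
theorem sym_mem_generated_of_one {k : ℕ} (hk : 0 < k) {χ : Signs →* ℤˣ} {v : Fock}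
    {p : Chirality → ℤ} (h1 : sym k χ p 1 ∈ generated k v) (P : Osc) :
    sym k χ p P ∈ generated k v := by
  induction P using MvPolynomial.induction_on with
  | C a =>
    have : (MvPolynomial.C a : Osc) = a • 1 := by rw [MvPolynomial.smul_eq_C_mul, mul_one]
    rw [this, map_smul]
    exact Submodule.smul_mem _ _ h1
  | add P Q hP hQ => rw [map_add]; exact Submodule.add_mem _ hP hQ
  | mul_X P x hP =>
    obtain ⟨c, n⟩ := x
    have h := generators_apply_mem_generated
      (show mode k c (-(n : ℤ)) * mode k c 0 ∈ generators k from
        ⟨c, Or.inl ⟨_, _, rfl⟩⟩) hP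
    rw [mode_mul_mode_sym, oscMode_zero, map_smul, map_smul, oscMode_neg_natCast] at h
    rw [mul_comm]
    refine (Submodule.smul_mem_iff _ (div_ne_zero ?_ (sqrt_two_mul_ne_zero hk))).1 h
    have : (k : ℤ) * (2 * p c + 1) ≠ 0 := mul_ne_zero (by exact_mod_cast hk.ne') (by omega)
    exact_mod_cast this

theorem sym_add_single_mem_generated {k : ℕ} (hk : 0 < k) {χ : Signs →* ℤˣ} {v : Fock}
    {p : Chirality → ℤ} {c : Chirality} (h : sym k χ p 1 ∈ generated k v) :
    sym k χ (p + Pi.single c 1) 1 ∈ generated k v := by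
  -- This mode number makes the required power of `z` zero for `J^+` at `p`, so `J^+` sends the
  -- ground state to a ground state. The contribution of `J^-` is unspecified and will be removed.
  have hE := generators_apply_mem_generated
    (show current k c 1 (-k - k * (2 * p c + 1)) + current k c (-1) (-k - k * (2 * p c + 1)) ∈
      generators k from ⟨c, Or.inr (Or.inl ⟨_, rfl⟩)⟩) h
  rw [current_add_sym] at hE
  have h1 : siteCoeff k c (-k - k * (2 * p c + 1)) p 1 1 = 1 := by
    have : -(-(k : ℤ) - k * (2 * p c + 1)) - k - ((1 : ℤˣ) : ℤ) * (k * (2 * p c + 1)) = 0 := by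
      push_cast; ring
    rw [siteCoeff, this, vertexCoeff_zero_one]
  rw [h1] at hE
  have hZ := generators_apply_mem_generated
    (show mode k c 0 * mode k c 0 ∈ generators k from ⟨c, Or.inl ⟨_, _, rfl⟩⟩) hE
  rw [map_add, zero_mode_sq_sym hk, zero_mode_sq_sym hk] at hZ
  -- Subtracting the `α_0²`-eigenvalue of the site `p - 1` kills the `J^-` term, whatever its
  -- oscillator part.
  have hD := Submodule.sub_mem _ hZ (Submodule.smul_mem _
    ((k : ℂ) * (2 * ((p + Pi.single c (-1) : Chirality → ℤ) c : ℂ) + 1) ^ 2 / 2) hE)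
  rw [smul_add, add_sub_add_right_eq_sub, ← sub_smul] at hD
  -- The surviving coefficient is the difference of the eigenvalues at `p + 1` and `p - 1`, namely
  -- `4 k (2 p c + 1)`.
  refine (Submodule.smul_mem_iff _ ?_).1 hD
  have h2 : (k : ℂ) * (2 * (p c : ℂ) + 1) ≠ 0 := by
    have : (k : ℤ) * (2 * p c + 1) ≠ 0 := mul_ne_zero (by exact_mod_cast hk.ne') (by omega)
    exact_mod_cast this
  simp only [Pi.add_apply, Pi.single_eq_same]
  push_cast
  intro h0
  apply h2
  linear_combination h0 / 4

theorem generated_eq_symSpace {k : ℕ} (hk : 0 < k) (χ : Signs →* ℤˣ) :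
    generated k (sym k χ 0 1) = symSpace k χ := by
  refine le_antisymm (generated_le (sym_mem_symSpace _ _ _ _) fun A hA w hw =>
    generators_apply_mem_symSpace hA hw) ?_
  rw [symSpace_eq_iSup_nat]
  have key : ∀ a b : ℕ, sym k χ (fun c => (Chirality.rec a b c : ℕ)) 1 ∈
      generated k (sym k χ 0 1) := by
    intro a b
    induction a with
    | zero =>
      induction b with
      | zero =>
        convert self_mem_generated k (sym k χ 0 1) using 2
        congr 1
        funext c; cases c <;> rfl
      | succ b ih =>
        convert sym_add_single_mem_generated hk (c := .right) ih using 2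
        congr 1
        funext c; cases c <;> simp
    | succ a ih =>
      convert sym_add_single_mem_generated hk (c := .left) ih using 2
      congr 1
      funext c; cases c <;> simp
  refine iSup_le fun p => ?_
  rintro _ ⟨P, rfl⟩
  refine sym_mem_generated_of_one hk ?_ P
  convert key (p .left) (p .right) using 2
  congr 1
  funext c; cases c <;> rfl

/-! ## Identification of the modules -/

/-- The function on chiralities with the given values. -/
def pair {α : Type*} (a b : α) : Chirality → α
  | .left => a
  | .right => b

theorem pair_eta {α : Type*} (p : Chirality → α) : pair (p .left) (p .right) = p := by
  funext c; cases c <;> rfl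

/-- Functions on chiralities as pairs. -/
def pairEquiv (α : Type*) : α × α ≃ (Chirality → α) where
  toFun x := pair x.1 x.2
  invFun p := (p .left, p .right)
  left_inv _ := rfl
  right_inv p := pair_eta p

theorem sum_signs {M : Type*} [AddCommMonoid M] (f : Signs → M) :
    ∑ g, f g = f (pair 1 1) + f (pair (-1) (-1)) + f (pair 1 (-1)) + f (pair (-1) 1) := by
  rw [← (pairEquiv ℤˣ).sum_comp, Fintype.sum_prod_type]
  have : (Finset.univ : Finset ℤˣ) = {1, -1} := rfl
  have h1 : (1 : ℤˣ) ≠ -1 := by decide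
  simp only [this, Finset.sum_pair h1]
  change f (pair 1 1) + f (pair 1 (-1)) + (f (pair (-1) 1) + f (pair (-1) (-1))) = _
  abel

/-- The four kets are one orbit of sites, and the signs in front are the values of `χ`. This matches
the four sign patterns with the four characters. -/
theorem ground_eq_sym (k s s' : ℕ) (χ : Signs →* ℤˣ) :
    ground k s s' ((χ (pair (-1) (-1)) : ℤ) : ℂ) ((χ (pair 1 (-1)) : ℤ) : ℂ)
      ((χ (pair (-1) 1) : ℤ) : ℂ) = sym k χ (fun c => (pair s s' c : ℕ)) 1 := by
  have h1 : χ (pair 1 1) = 1 := by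
    rw [show (pair 1 1 : Signs) = 1 from pair_eta (1 : Signs), map_one]
  have hn : (-1 : ℤˣ) ≠ 1 := by decide
  rw [sym_apply, sum_signs, h1, ground]
  simp only [map_one, site, reflect, pair, hn, if_true, if_false, ket, Units.val_one,
    Int.cast_one, one_smul]
  have e1 : (k : ℤ) * (-1 - s - (-1 - s')) = -(k * (s - s')) := by ring
  have e2 : (k : ℤ) * (s - (-1 - s')) = k * (s + s' + 1) := by ring
  have e3 : (k : ℤ) * (-1 - s - s') = -(k * (s + s' + 1)) := by ring
  have e4 : (-1 - s + (-1 - s') + 1 : ℤ) = -(s + s' + 1) := by ring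
  have e5 : (s + (-1 - s') + 1 : ℤ) = s - s' := by ring
  have e6 : (-1 - s + s' + 1 : ℤ) = -(s - s') := by ring
  rw [e1, e2, e3, e4, e5, e6]

theorem word_span : Submodule.span ℂ {P : Osc | ∃ l r : List ℕ+,
    P = (l.map fun n => MvPolynomial.X (Chirality.left, n)).prod *
      (r.map fun n => MvPolynomial.X (Chirality.right, n)).prod} = ⊤ := by
  rw [eq_top_iff]
  rintro P -
  induction P using MvPolynomial.induction_on with
  | C a =>
    rw [← mul_one (MvPolynomial.C a), ← MvPolynomial.smul_eq_C_mul]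
    exact Submodule.smul_mem _ _ (Submodule.subset_span ⟨[], [], by simp⟩)
  | add P Q hP hQ => exact Submodule.add_mem _ hP hQ
  | mul_X P x hP =>
    induction hP using Submodule.span_induction with
    | zero => simp
    | add P Q _ _ hP hQ => rw [add_mul]; exact Submodule.add_mem _ hP hQ
    | smul a P _ hP => rw [smul_mul_assoc]; exact Submodule.smul_mem _ _ hP
    | mem P hP =>
      obtain ⟨l, r, rfl⟩ := hP
      obtain ⟨_ | _, n⟩ := x
      · refine Submodule.subset_span ⟨n :: l, r, ?_⟩
        simp only [List.map_cons, List.prod_cons]; ring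
      · refine Submodule.subset_span ⟨l, n :: r, ?_⟩
        simp only [List.map_cons, List.prod_cons]; ring

theorem prod_mode_sym (k : ℕ) (c : Chirality) (l : List ℕ+) (χ : Signs →* ℤˣ)
    (p : Chirality → ℤ) (P : Osc) :
    (l.map fun n : ℕ+ => mode k c (-(n : ℤ))).prod (sym k χ p P) =
      sym k (χ * signChar c ^ l.length) p
        ((l.map fun n => MvPolynomial.X (c, n)).prod * P) := by
  induction l with
  | nil => simp
  | cons n l ih =>
    simp only [List.map_cons, List.prod_cons, Module.End.mul_apply, ih, mode_sym,
      oscMode_neg_natCast, List.length_cons, pow_succ, mul_assoc]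

theorem char_pow_eq (χ : Signs →* ℤˣ) {a b : ℕ} (h : a ≡ b [MOD 2]) : χ ^ a = χ ^ b := by
  have h2 : χ ^ 2 = 1 := by ext g; simp
  rw [← Nat.div_add_mod a 2, ← Nat.div_add_mod b 2, show a % 2 = b % 2 from h]
  simp only [pow_add, pow_mul, h2, one_pow]

theorem strings_eq_span (k a b : ℕ) (g : Fock) : strings k a b g =
    Submodule.span ℂ {w | ∃ l r : List ℕ+, l.length ≡ a [MOD 2] ∧ r.length ≡ b [MOD 2] ∧
      w = (l.map fun n : ℕ+ => mode k .left (-(n : ℤ))).prod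
        ((r.map fun n : ℕ+ => mode k .right (-(n : ℤ))).prod g)} := by
  simp [strings, ← List.map_eq_flatMap, Function.comp_def]

theorem strings_le_range_sym (k a b : ℕ) (χ : Signs →* ℤˣ) (p : Chirality → ℤ) :
    strings k a b (sym k χ p 1) ≤
      LinearMap.range (sym k (χ * signChar .right ^ b * signChar .left ^ a) p) := by
  rw [strings_eq_span, Submodule.span_le]
  rintro _ ⟨l, r, hl, hr, rfl⟩
  rw [prod_mode_sym, prod_mode_sym, char_pow_eq _ hl, char_pow_eq _ hr]
  exact ⟨_, rfl⟩

theorem sym_word_mem_strings (k : ℕ) (χ : Signs →* ℤˣ) (p : Chirality → ℤ) (l r : List ℕ+) :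
    sym k χ p ((l.map fun n => MvPolynomial.X (Chirality.left, n)).prod *
      (r.map fun n => MvPolynomial.X (Chirality.right, n)).prod) ∈
      strings k (l.length % 2) (r.length % 2)
        (sym k (χ * signChar .left ^ (l.length % 2) * signChar .right ^ (r.length % 2)) p 1) := by
  rw [strings_eq_span]
  refine Submodule.subset_span ⟨l, r, (Nat.mod_modEq _ _).symm, (Nat.mod_modEq _ _).symm, ?_⟩
  rw [prod_mode_sym, prod_mode_sym, char_pow_eq _ (Nat.mod_modEq _ _),
    char_pow_eq _ (Nat.mod_modEq _ _), mul_one]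
  congr 2
  refine MonoidHom.ext fun g => ?_
  rcases Int.units_eq_one_or (signChar .left g) with h | h <;>
  rcases Int.units_eq_one_or (signChar .right g) with h' | h' <;>
    simp [h, h', mul_assoc, ← mul_pow]

/-- A word with `i` left and `j` right creation operators multiplies the character by the
corresponding powers of the sign characters. To land in `χ` it must start from the ground state of
the compensating character, which depends only on the parities of `i` and `j`. -/
theorem range_sym_eq_strings (k : ℕ) (χ : Signs →* ℤˣ) (p : Chirality → ℤ) :
    LinearMap.range (sym k χ p) =
      strings k 0 0 (sym k χ p 1) ⊔
      strings k 1 1 (sym k (χ * signChar .left * signChar .right) p 1) ⊔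
      strings k 1 0 (sym k (χ * signChar .left) p 1) ⊔
      strings k 0 1 (sym k (χ * signChar .right) p 1) := by
  refine le_antisymm ?_ ?_
  · rw [LinearMap.range_eq_map, ← word_span, Submodule.map_span, Submodule.span_le]
    rintro _ ⟨_, ⟨l, r, rfl⟩, rfl⟩
    have h := sym_word_mem_strings k χ p l r
    rw [SetLike.mem_coe]
    rcases Nat.mod_two_eq_zero_or_one l.length with hl | hl <;>
    rcases Nat.mod_two_eq_zero_or_one r.length with hr | hr <;>
    simp only [hl, hr, pow_zero, pow_one, mul_one] at h
    · exact Submodule.mem_sup_left (Submodule.mem_sup_left (Submodule.mem_sup_left h))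
    · exact Submodule.mem_sup_right h
    · exact Submodule.mem_sup_left (Submodule.mem_sup_right h)
    · exact Submodule.mem_sup_left (Submodule.mem_sup_left (Submodule.mem_sup_right h))
  · have h0 := strings_le_range_sym k 0 0 χ p
    have h1 := strings_le_range_sym k 1 1 (χ * signChar .left * signChar .right) p
    have h2 := strings_le_range_sym k 1 0 (χ * signChar .left) p
    have h3 := strings_le_range_sym k 0 1 (χ * signChar .right) p
    simp only [pow_zero, pow_one, mul_one, char_mul_self] at h0 h1 h2 h3
    exact sup_le (sup_le (sup_le h0 h1) h2) h3

theorem HUv_eq (k s s' : ℕ) :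
    HUv k s s' = LinearMap.range (sym k 1 fun c => (pair s s' c : ℕ)) := by
  rw [range_sym_eq_strings, HUv]
  simp only [← ground_eq_sym]
  simp [signChar, pair]

theorem HUb_eq (k s s' : ℕ) :
    HUb k s s' = LinearMap.range
      (sym k (signChar .left * signChar .right) fun c => (pair s s' c : ℕ)) := by
  rw [range_sym_eq_strings, HUb]
  simp only [← ground_eq_sym]
  simp [signChar, pair]
  ac_rfl

theorem iSup_pair {L : Type*} [CompleteLattice L] (f : (Chirality → ℕ) → L) :
    ⨆ (s : ℕ) (s' : ℕ), f (pair s s') = ⨆ p, f p := by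
  refine le_antisymm (iSup₂_le fun s s' => le_iSup f _) (iSup_le fun p => ?_)
  exact le_iSup₂_of_le (p .left) (p .right) (by rw [pair_eta])

theorem Hv_eq_symSpace (k : ℕ) : Hv k = symSpace k 1 := by
  rw [symSpace_eq_iSup_nat, ← iSup_pair, Hv]
  simp only [HUv_eq]

theorem Hb_eq_symSpace (k : ℕ) : Hb k = symSpace k (signChar .left * signChar .right) := by
  rw [symSpace_eq_iSup_nat, ← iSup_pair, Hb]
  simp only [HUb_eq]

theorem sym_zero_one (k : ℕ) (χ : Signs →* ℤˣ) : sym k χ 0 1 = ket 1 0 +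
    ((χ (pair (-1) (-1)) : ℤ) : ℂ) • ket (-1) 0 + ((χ (pair 1 (-1)) : ℤ) : ℂ) • ket 0 k +
      ((χ (pair (-1) 1) : ℤ) : ℂ) • ket 0 (-k) := by
  have h := ground_eq_sym k 0 0 χ
  have h0 : (fun c => ((pair 0 0 c : ℕ) : ℤ)) = 0 := by funext c; cases c <;> rfl
  rw [h0] at h
  rw [← h, ground]
  simp

theorem generated_vacuum {k : ℕ} (hk : 0 < k) :
    generated k (ket 1 0 + ket (-1) 0 + (ket 0 k + ket 0 (-k))) = Hv k := by
  rw [Hv_eq_symSpace, ← generated_eq_symSpace hk, sym_zero_one]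
  congr 1
  simp [add_assoc]

theorem generated_antivacuum {k : ℕ} (hk : 0 < k) :
    generated k (ket 1 0 + ket (-1) 0 - (ket 0 k + ket 0 (-k))) = Hb k := by
  rw [Hb_eq_symSpace, ← generated_eq_symSpace hk, sym_zero_one]
  congr 1
  simp [signChar, pair]
  abel

/-! ## The spectrum of the Virasoro zero modes -/

theorem level_eq_sum (c : Chirality) (d : (Chirality × ℕ+) →₀ ℕ) :
    level c d = ∑ n ∈ d.support.preimage (Prod.mk c) (Prod.mk_right_injective c).injOn,
      (d (c, n) : ℤ) * ((n : ℕ) : ℤ) := by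
  have h := Finset.sum_preimage (Prod.mk c) d.support (Prod.mk_right_injective c).injOn
    (fun x => if x.1 = c then (d x : ℤ) * ((x.2 : ℕ) : ℤ) else 0) (by
      rintro ⟨c', n⟩ - hn
      rw [if_neg]
      rintro rfl
      exact hn ⟨n, rfl⟩)
  simpa [level, Finsupp.sum] using h.symm

theorem creation_annihilation_single (k : ℕ) (c : Chirality) (p : ℤ × ℤ)
    (d : (Chirality × ℕ+) →₀ ℕ) (n : ℕ+) :
    mode k c (-(n : ℤ)) (mode k c (n : ℤ) (Finsupp.single p (MvPolynomial.monomial d 1))) =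
      ((d (c, n) : ℂ) * ((n : ℕ) : ℂ)) • Finsupp.single p (MvPolynomial.monomial d 1) := by
  rw [mode_single, mode_single, oscMode_neg_natCast, oscMode_natCast, Finsupp.smul_single]
  congr 1
  have h := MvPolynomial.X_mul_pderiv_monomial (R := ℂ) (i := (c, n)) (m := d) (r := 1)
  rw [ann, LinearMap.smul_apply, mul_smul_comm]
  refine (congrArg _ h).trans ?_
  rw [mul_comm, mul_smul, Nat.cast_smul_eq_nsmul ℂ (d (c, n))]

/-- Normal ordering makes the indices `n` and `-n` contribute the same number operator. The factor
one half thus leaves the level once and halves the zero-mode term `r² / (2k)`. -/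
theorem vir0_single_monomial {k : ℕ} (hk : 0 < k) (c : Chirality) (p : ℤ × ℤ)
    (d : (Chirality × ℕ+) →₀ ℕ) :
    vir0 k c (Finsupp.single p (MvPolynomial.monomial d 1)) =
      ((charge k c p : ℂ) ^ 2 / (4 * k) + (level c d : ℂ)) •
        Finsupp.single p (MvPolynomial.monomial d 1) := by
  set v : Fock := Finsupp.single p (MvPolynomial.monomial d 1) with hv
  let T : Finset ℕ+ := d.support.preimage (Prod.mk c) (Prod.mk_right_injective c).injOn
  let pos : ℕ+ ↪ ℤ := ⟨fun n => n, fun a b h => by simpa using h⟩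
  let neg : ℕ+ ↪ ℤ := ⟨fun n => -n, fun a b h => by simpa using h⟩
  let f : ℤ → Fock := fun n => mode k c (-|n|) (mode k c |n| v)
  have hpos : ∀ n : ℕ+, f n = ((d (c, n) : ℂ) * ((n : ℕ) : ℂ)) • v := fun n => by
    simp only [f, abs_of_nonneg (show (0 : ℤ) ≤ ((n : ℕ) : ℤ) by positivity)]
    exact creation_annihilation_single k c p d n
  have hneg : ∀ n : ℕ+, f (-n) = ((d (c, n) : ℂ) * ((n : ℕ) : ℂ)) • v := fun n => by
    rw [← hpos]; simp only [f, abs_neg]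
  have hzero : f 0 = ((charge k c p : ℂ) ^ 2 / (2 * k)) • v := by
    simp only [f, abs_zero, neg_zero, hv, mode_single, oscMode_zero, smul_smul,
      ← Finsupp.smul_single]
    congr 1
    rw [div_mul_div_comm, sqrt_two_mul_mul_self, sq]
  have hsupp : Function.support f ⊆ (({0} ∪ (T.map pos ∪ T.map neg) : Finset ℤ) : Set ℤ) := by
    intro n hn
    rcases Int.lt_trichotomy n 0 with h | h | h
    · obtain ⟨m, rfl⟩ : ∃ m : ℕ+, n = -(m : ℤ) := ⟨⟨n.natAbs, by omega⟩, by rw [PNat.mk_coe]; omega⟩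
      have hm : d (c, m) ≠ 0 := fun h0 => hn (by rw [hneg, h0]; simp)
      have : m ∈ T := by simpa [T] using hm
      simp only [Finset.coe_union, Set.mem_union, Finset.mem_coe]
      exact Or.inr (Or.inr (Finset.mem_map_of_mem neg this))
    · simp [h]
    · obtain ⟨m, rfl⟩ : ∃ m : ℕ+, n = (m : ℤ) := ⟨⟨n.natAbs, by omega⟩, by rw [PNat.mk_coe]; omega⟩
      have hm : d (c, m) ≠ 0 := fun h0 => hn (by rw [hpos, h0]; simp)
      have : m ∈ T := by simpa [T] using hm
      simp only [Finset.coe_union, Set.mem_union, Finset.mem_coe]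
      exact Or.inr (Or.inl (Finset.mem_map_of_mem pos this))
  have hd1 : Disjoint (T.map pos) (T.map neg) := by
    rw [Finset.disjoint_left]
    intro n hn hn'
    obtain ⟨a, -, rfl⟩ := Finset.mem_map.1 hn
    obtain ⟨b, -, hb⟩ := Finset.mem_map.1 hn'
    have h1 := a.pos
    have h2 := b.pos
    change -((b : ℕ) : ℤ) = ((a : ℕ) : ℤ) at hb
    omega
  have hd0 : Disjoint ({0} : Finset ℤ) (T.map pos ∪ T.map neg) := by
    rw [Finset.disjoint_singleton_left, Finset.mem_union, not_or]
    constructor <;> intro hn <;> obtain ⟨a, -, ha⟩ := Finset.mem_map.1 hn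
    · change ((a : ℕ) : ℤ) = 0 at ha
      have h1 := a.pos
      omega
    · change -((a : ℕ) : ℤ) = 0 at ha
      have h1 := a.pos
      omega
  have hsum : ∑ᶠ n, f n =
      ((charge k c p : ℂ) ^ 2 / (2 * k) + (level c d : ℂ) + (level c d : ℂ)) • v := by
    rw [finsum_eq_sum_of_support_subset f hsupp, Finset.sum_union hd0, Finset.sum_union hd1,
      Finset.sum_singleton, Finset.sum_map, Finset.sum_map, hzero]
    have h1 : ∑ n ∈ T, f (pos n) = (level c d : ℂ) • v := by
      rw [level_eq_sum]
      push_cast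
      rw [Finset.sum_smul]
      exact Finset.sum_congr rfl fun n _ => hpos n
    have h2 : ∑ n ∈ T, f (neg n) = (level c d : ℂ) • v := by
      rw [level_eq_sum]
      push_cast
      rw [Finset.sum_smul]
      exact Finset.sum_congr rfl fun n _ => hneg n
    rw [h1, h2, add_smul, add_smul, add_assoc]
  have h : vir0 k c v = (1 / 2 : ℂ) • ∑ᶠ n, f n := rfl
  rw [h, hsum, smul_smul]
  congr 1
  have h3 : (k : ℂ) ≠ 0 := by exact_mod_cast hk.ne'
  field_simp
  ring

theorem twist_monomial (g : Signs) (d : (Chirality × ℕ+) →₀ ℕ) :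
    ∃ a : ℂ, twist g (MvPolynomial.monomial d 1) = a • MvPolynomial.monomial d 1 := by
  refine ⟨d.prod fun x n => ((g x.1 : ℤ) : ℂ) ^ n, ?_⟩
  rw [twist, MvPolynomial.aeval_monomial, map_one, one_mul, MvPolynomial.monomial_eq]
  simp only [smul_pow, Finsupp.prod, map_one, one_mul]
  rw [Finset.prod_smul]

/-- All summands of the group sum share one eigenvalue: the charge enters squared, and `twist` only
rescales a monomial. -/
theorem vir0_sym_monomial {k : ℕ} (hk : 0 < k) (c : Chirality) (χ : Signs →* ℤˣ)
    (p : Chirality → ℤ) (d : (Chirality × ℕ+) →₀ ℕ) :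
    vir0 k c (sym k χ p (MvPolynomial.monomial d 1)) =
      ((k : ℂ) * ((p c : ℂ) + 1 / 2) ^ 2 + (level c d : ℂ)) •
        sym k χ p (MvPolynomial.monomial d 1) := by
  rw [sym_apply, map_sum, Finset.smul_sum]
  refine Finset.sum_congr rfl fun g _ => ?_
  obtain ⟨a, ha⟩ := twist_monomial g d
  rw [ha, ← Finsupp.smul_single, map_smul, map_smul, vir0_single_monomial hk, charge_site,
    reflect_charge]
  simp only [smul_smul]
  congr 1
  have h3 : (k : ℂ) ≠ 0 := by exact_mod_cast hk.ne'
  have h4 := sign_mul_self (g c)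
  push_cast
  field_simp
  linear_combination (4 * a * k * (2 * (p c : ℂ) + 1) ^ 2) * h4

/-! ## A basis of eigenvectors -/

/-- A nontrivial reflection sends some `p c ≥ 0` to `-1 - p c < 0`. Thus an orbit meets the positive
quadrant at most once, with trivial stabilizer. -/
theorem natCast_reflect_eq {g : Signs} {p q : Chirality → ℕ}
    (h : reflect g (fun c => (p c : ℤ)) = fun c => (q c : ℤ)) : g = 1 ∧ p = q := by
  have h1 : g = 1 := by
    funext c
    by_contra hc
    have hc' : g c ≠ 1 := hc
    have := congrFun h c
    simp only [reflect, if_neg hc'] at this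
    omega
  refine ⟨h1, ?_⟩
  funext c
  have := congrFun h c
  simpa [reflect, h1] using this

theorem reflect_one (p : Chirality → ℤ) : reflect 1 p = p := by
  funext c; simp [reflect]

theorem sym_apply_site {k : ℕ} (hk : 0 < k) (χ : Signs →* ℤˣ) (p q : Chirality → ℕ) (P : Osc) :
    sym k χ (fun c => p c) P (site k fun c => q c) = Finsupp.single p P q := by
  rw [sym_apply, Finset.sum_apply', Finset.sum_eq_single 1]
  · rw [map_one, twist_one, reflect_one]
    simp only [Units.val_one, Int.cast_one, one_smul, Finsupp.single_apply]
    refine if_congr ((site_injective hk).eq_iff.trans ⟨fun h => ?_, fun h => by rw [h]⟩) rfl rfl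
    funext c
    exact_mod_cast congrFun h c
  · intro g _ hg
    rw [Finsupp.smul_apply, Finsupp.single_apply, if_neg, smul_zero]
    exact fun h => hg (natCast_reflect_eq (site_injective hk h)).1
  · exact fun h => absurd (Finset.mem_univ _) h

/-- The symmetrized monomials over the sites with positive charges. -/
def eigenvector (k : ℕ) (χ : Signs →* ℤˣ)
    (x : (Chirality → ℕ) × ((Chirality × ℕ+) →₀ ℕ)) : Fock :=
  sym k χ (fun c => x.1 c) (MvPolynomial.monomial x.2 1)

theorem linearIndependent_eigenvector {k : ℕ} (hk : 0 < k) (χ : Signs →* ℤˣ) :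
    LinearIndependent ℂ (eigenvector k χ) := by
  have hi : Function.Injective fun q : Chirality → ℕ => site k fun c => (q c : ℤ) := by
    intro p q h
    have := site_injective hk h
    funext c
    exact_mod_cast congrFun this c
  -- Restricting to sites in the positive quadrant keeps only the term `g = 1`, which turns each
  -- eigenvector into a plain monomial at one site.
  refine LinearIndependent.of_comp
    (Finsupp.lcomapDomain (R := ℂ) (M := Osc) (fun q : Chirality → ℕ => site k fun c => (q c : ℤ))
      hi) ?_
  have h := Finsupp.linearIndependent_single (R := ℂ) (M := Osc) (ι := Chirality → ℕ)
    (φ := fun _ => (Chirality × ℕ+) →₀ ℕ) (fun _ d => MvPolynomial.monomial d 1)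
    (fun _ => by
      simpa using (MvPolynomial.basisMonomials (Chirality × ℕ+) ℂ).linearIndependent)
  have h2 := h.comp (Equiv.sigmaEquivProd (Chirality → ℕ) ((Chirality × ℕ+) →₀ ℕ)).symm
    (Equiv.injective _)
  convert h2 using 1
  funext x
  refine Finsupp.ext fun q => ?_
  exact sym_apply_site hk χ x.1 q _

theorem symSpace_eq_span (k : ℕ) (χ : Signs →* ℤˣ) :
    symSpace k χ = Submodule.span ℂ (Set.range (eigenvector k χ)) := by
  refine le_antisymm ?_ ?_
  · rw [symSpace_eq_iSup_nat]
    refine iSup_le fun p => ?_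
    rw [LinearMap.range_eq_map, ← (MvPolynomial.basisMonomials (Chirality × ℕ+) ℂ).span_eq,
      Submodule.map_span, Submodule.span_le]
    rintro _ ⟨_, ⟨d, rfl⟩, rfl⟩
    exact Submodule.subset_span ⟨(p, d), by simp [eigenvector]⟩
  · rw [Submodule.span_le]
    rintro _ ⟨x, rfl⟩
    exact sym_mem_symSpace _ _ _ _

/-! ## Traces from bases of eigenvectors -/

/-- An eigenvector expanded in an eigenbasis can only involve basis vectors with its own
eigenvalues. -/
theorem weightSpace_span {k : ℕ} {I : Type*} {b : I → Fock} (hb : LinearIndependent ℂ b)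
    {w : I → ℝ × ℝ} (hl : ∀ i, vir0 k .left (b i) = ((w i).1 : ℂ) • b i)
    (hr : ∀ i, vir0 k .right (b i) = ((w i).2 : ℂ) • b i) (h : ℝ × ℝ) :
    weightSpace k (Submodule.span ℂ (Set.range b)) h =
      Submodule.span ℂ (Set.range fun i : {i // w i = h} => b i) := by
  refine le_antisymm ?_ ?_
  · rintro v ⟨⟨hv, h1⟩, h2⟩
    obtain ⟨l, rfl⟩ := (Finsupp.mem_span_range_iff_exists_finsupp).1 hv
    have key : ∀ (A : Module.End ℂ Fock) (u : I → ℝ) (a : ℝ), (∀ i, A (b i) = (u i : ℂ) • b i) →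
        A (l.sum fun i a => a • b i) = (a : ℂ) • (l.sum fun i a => a • b i) →
        ∀ i ∈ l.support, u i = a := by
      intro A u a hu ha i hi
      rw [Finsupp.sum, map_sum, Finset.smul_sum, ← sub_eq_zero, ← Finset.sum_sub_distrib] at ha
      have h0 : ∑ i ∈ l.support, (l i * ((u i : ℂ) - a)) • b i = 0 := by
        rw [← ha]
        refine Finset.sum_congr rfl fun i _ => ?_
        rw [map_smul, hu]
        module
      have := linearIndependent_iff'.1 hb _ _ h0 i hi
      rcases mul_eq_zero.1 this with h | h
      · exact absurd h (Finsupp.mem_support_iff.1 hi)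
      · exact_mod_cast sub_eq_zero.1 h
    have k1 := key _ (fun i => (w i).1) h.1 hl (Module.End.mem_eigenspace_iff.1 h1)
    have k2 := key _ (fun i => (w i).2) h.2 hr (Module.End.mem_eigenspace_iff.1 h2)
    refine Submodule.sum_mem _ fun i hi => Submodule.smul_mem _ _ ?_
    exact Submodule.subset_span ⟨⟨i, Prod.ext (k1 i hi) (k2 i hi)⟩, rfl⟩
  · rw [Submodule.span_le]
    rintro _ ⟨⟨i, rfl⟩, rfl⟩
    exact ⟨⟨Submodule.subset_span ⟨i, rfl⟩, Module.End.mem_eigenspace_iff.2 (hl i)⟩,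
      Module.End.mem_eigenspace_iff.2 (hr i)⟩

theorem isTrace_span {k : ℕ} {I : Type*} {b : I → Fock} (hb : LinearIndependent ℂ b)
    {w : I → ℝ × ℝ} (hl : ∀ i, vir0 k .left (b i) = ((w i).1 : ℂ) • b i)
    (hr : ∀ i, vir0 k .right (b i) = ((w i).2 : ℂ) • b i) {q t : ℝ} (hq : 0 < q)
    (ht : HasSum (fun i => q ^ ((w i).1 - 1 / 24) * q ^ ((w i).2 - 1 / 24)) t) :
    IsTrace k (Submodule.span ℂ (Set.range b)) q t := by
  -- An infinite fibre would make a positive constant summable, so finite multiplicity follows from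
  -- convergence of the trace.
  have hfin : ∀ h : ℝ × ℝ, Finite {i // w i = h} := by
    intro h
    by_contra hinf
    rw [not_finite_iff_infinite] at hinf
    have hs : Summable fun i : {i // w i = h} => q ^ (h.1 - 1 / 24) * q ^ (h.2 - 1 / 24) := by
      refine (ht.summable.comp_injective (Subtype.val_injective (p := fun i => w i = h))).congr
        fun i => ?_
      simp only [Function.comp_apply, i.2]
    have := (summable_const_iff _).1 hs
    have h1 := Real.rpow_pos_of_pos hq (h.1 - 1 / 24)
    have h2 := Real.rpow_pos_of_pos hq (h.2 - 1 / 24)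
    exact (mul_pos h1 h2).ne' this
  refine ⟨le_antisymm ?_ ?_, fun h => ?_, ?_⟩
  · rw [Submodule.span_le]
    rintro _ ⟨i, rfl⟩
    refine Submodule.mem_iSup_of_mem (w i) ?_
    rw [weightSpace_span hb hl hr]
    exact Submodule.subset_span ⟨⟨i, rfl⟩, rfl⟩
  · exact iSup_le fun h => inf_le_left.trans inf_le_left
  · rw [weightSpace_span hb hl hr]
    have := hfin h
    exact FiniteDimensional.span_of_finite ℂ (Set.finite_range _)
  · have ht' := (Equiv.hasSum_iff (Equiv.sigmaFiberEquiv w)).2 ht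
    refine HasSum.sigma ht' fun h => ?_
    have := hfin h
    have := Fintype.ofFinite {i // w i = h}
    have hli : LinearIndependent ℂ fun i : {i // w i = h} => b i :=
      hb.comp _ Subtype.val_injective
    rw [weightSpace_span hb hl hr, finrank_span_eq_card hli]
    convert hasSum_fintype _ using 1
    rw [← nsmul_eq_mul, ← Finset.card_univ, ← Finset.sum_const]
    refine Finset.sum_congr rfl fun i _ => ?_
    have : w (Equiv.sigmaFiberEquiv w ⟨h, i⟩) = h := i.2
    simp only [Function.comp_apply, this]

/-! ### Theta series and Euler products. -/

open Filter Topology in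
/-- The generating function of multisets: `∑_d ∏_x a_x ^ {d_x} = ∏_x (1 - a_x)⁻¹`. -/
theorem hasSum_finsupp_prod_pow {X : Type*} {a : X → ℝ} (h0 : ∀ x, 0 ≤ a x) (h1 : ∀ x, a x < 1)
    {E : ℝ} (hE : HasProd (fun x => 1 - a x) E) (hE0 : E ≠ 0) :
    HasSum (fun d : X →₀ ℕ => d.prod fun x n => a x ^ n) E⁻¹ := by
  classical
  have hpos : ∀ x, 0 < 1 - a x := fun x => sub_pos.2 (h1 x)
  have hZ : Tendsto (fun s : Finset X => ∏ x ∈ s, (1 - a x)⁻¹) atTop (𝓝 E⁻¹) := hE.inv₀ hE0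
  have hmono : Monotone fun s : Finset X => ∏ x ∈ s, (1 - a x)⁻¹ := by
    intro s t hst
    dsimp only
    refine Finset.prod_le_prod_of_subset_of_one_le hst (fun x _ => (inv_pos.2 (hpos x)).le)
      fun x _ _ => (one_le_inv₀ (hpos x)).2 (by linarith [h0 x])
  have hterm : ∀ d : X →₀ ℕ, 0 ≤ d.prod fun x n => a x ^ n := fun d =>
    Finset.prod_nonneg fun x _ => pow_nonneg (h0 x) _
  -- Multisets supported in `s` with multiplicities below `N` expand a finite product of truncated
  -- geometric series.
  have hbox : ∀ (s : Finset X) (N : ℕ),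
      ∑ d ∈ s.finsupp (fun _ => Finset.range N), (d.prod fun x n => a x ^ n) =
        ∏ x ∈ s, ∑ i ∈ Finset.range N, a x ^ i := by
    intro s N
    rw [Finset.finsupp, Finset.sum_map, Finset.prod_sum]
    refine Finset.sum_congr rfl fun f _ => ?_
    simp only [Function.Embedding.coeFn_mk]
    rw [Finsupp.prod_indicator_index_eq_prod_attach _ (by simp)]
  refine hasSum_of_isLUB_of_nonneg _ hterm ⟨?_, ?_⟩
  · rintro _ ⟨D, rfl⟩
    -- Any finite set of multisets fits into such a box, which bounds every partial sum by `E⁻¹`.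
    let s : Finset X := D.sup Finsupp.support
    let N : ℕ := D.sup (fun d => d.support.sup d) + 1
    have hsub : D ⊆ s.finsupp (fun _ => Finset.range N) := by
      intro d hd
      refine Finset.mem_finsupp_iff.2 ⟨Finset.le_sup (f := Finsupp.support) hd, fun x _ => ?_⟩
      rw [Finset.mem_range, Nat.lt_succ_iff]
      by_cases hx : d x = 0
      · simp [hx]
      · exact (Finset.le_sup (f := d) (Finsupp.mem_support_iff.2 hx)).trans
          (Finset.le_sup (f := fun d : X →₀ ℕ => d.support.sup d) hd)
    calc ∑ d ∈ D, (d.prod fun x n => a x ^ n)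
        ≤ ∑ d ∈ s.finsupp (fun _ => Finset.range N), (d.prod fun x n => a x ^ n) :=
          Finset.sum_le_sum_of_subset_of_nonneg hsub fun d _ _ => hterm d
      _ = ∏ x ∈ s, ∑ i ∈ Finset.range N, a x ^ i := hbox s N
      _ ≤ ∏ x ∈ s, (1 - a x)⁻¹ := by
          refine Finset.prod_le_prod (fun x _ => Finset.sum_nonneg fun i _ => pow_nonneg (h0 x) i)
            fun x _ => ?_
          rw [← tsum_geometric_of_lt_one (h0 x) (h1 x)]
          exact (summable_geometric_of_lt_one (h0 x) (h1 x)).sum_le_tsum _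
            fun i _ => pow_nonneg (h0 x) i
      _ ≤ E⁻¹ := hmono.ge_of_tendsto hZ s
  · intro B hB
    -- For the reverse bound, let `N` tend to infinity for fixed `s`, then let `s` exhaust `X`.
    refine le_of_tendsto hZ (Eventually.of_forall fun s => ?_)
    have hlim : Tendsto (fun N => ∏ x ∈ s, ∑ i ∈ Finset.range N, a x ^ i) atTop
        (𝓝 (∏ x ∈ s, (1 - a x)⁻¹)) :=
      tendsto_finsetProd _ fun x _ =>
        (hasSum_geometric_of_lt_one (h0 x) (h1 x)).tendsto_sum_nat
    refine le_of_tendsto hlim (Eventually.of_forall fun N => ?_)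
    rw [← hbox]
    exact hB ⟨_, rfl⟩

theorem prod_pow_eq_zpow_level {q : ℝ} (hq : 0 < q) (d : (Chirality × ℕ+) →₀ ℕ) :
    (d.prod fun x n => (q ^ (x.2 : ℕ)) ^ n) = q ^ (level .left d + level .right d) := by
  induction d using Finsupp.induction_linear with
  | zero => simp [level]
  | add d d' h h' =>
    rw [Finsupp.prod_add_index' (by simp) (fun x m n => pow_add _ m n), h, h', level_add,
      level_add, ← zpow_add₀ hq.ne']
    congr 1
    ring
  | single x n =>
    obtain ⟨_ | _, m⟩ := x <;> simp [level] <;> norm_cast <;> rw [← pow_mul, mul_comm]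

theorem hasProd_one_sub_pow {q : ℝ} (hq : 0 < q) (hq1 : q < 1) :
    (∏' n : ℕ, (1 - q ^ (n + 1))) ≠ 0 ∧
      HasProd (fun x : Chirality × ℕ+ => 1 - q ^ (x.2 : ℕ))
        ((∏' n : ℕ, (1 - q ^ (n + 1))) ^ 2) := by
  have hs : Summable fun n : ℕ => q ^ (n + 1) :=
    (summable_nat_add_iff 1).2 (summable_geometric_of_lt_one hq.le hq1)
  have hsn : Summable fun n : ℕ => ‖-q ^ (n + 1)‖ := by
    refine hs.congr fun n => ?_
    rw [norm_neg, Real.norm_of_nonneg (by positivity)]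
  have hne : ∀ n : ℕ, 1 + -q ^ (n + 1) ≠ 0 := fun n => by
    have := pow_lt_one₀ hq.le hq1 n.succ_ne_zero
    simp only [Nat.succ_eq_add_one] at this
    linarith
  have hm : HasProd (fun n : ℕ => 1 - q ^ (n + 1)) (∏' n : ℕ, (1 - q ^ (n + 1))) := by
    have := (multipliable_one_add_of_summable hsn).hasProd
    simpa only [← sub_eq_add_neg] using this
  refine ⟨by simpa only [← sub_eq_add_neg] using tprod_one_add_ne_zero_of_summable hne hsn, ?_⟩
  have hm' : HasProd (fun n : ℕ+ => 1 - q ^ (n : ℕ)) (∏' n : ℕ, (1 - q ^ (n + 1))) := by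
    rw [← Equiv.pnatEquivNat.symm.hasProd_iff]
    exact hm
  have hs2 : Summable fun x : Chirality × ℕ+ => ‖-q ^ (x.2 : ℕ)‖ := by
    have hs' : Summable fun n : ℕ+ => ‖-q ^ (n : ℕ)‖ := by
      rw [← Equiv.pnatEquivNat.symm.summable_iff]
      exact hsn
    have := (hasSum_fintype fun _ : Chirality => (1 : ℝ)).summable.mul_of_nonneg hs'
      (fun _ => zero_le_one) (fun _ => norm_nonneg _)
    simpa only [one_mul] using this
  have hP := (multipliable_one_add_of_summable hs2).hasProd
  simp only [← sub_eq_add_neg] at hP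
  -- Absolute convergence allows multiplying fibre by fibre; the two chiralities give two equal
  -- factors.
  have hf := (hP.prod_fiberwise fun _ => hm').unique (hasProd_fintype _)
  rw [hf, Finset.prod_const] at hP
  exact hP

theorem summable_theta {k : ℕ} (hk : 0 < k) {q : ℝ} (hq : 0 < q) (hq1 : q < 1) :
    Summable fun n : ℕ => q ^ ((k : ℝ) * ((n : ℝ) + 1 / 2) ^ 2) := by
  refine Summable.of_nonneg_of_le (fun n => (Real.rpow_pos_of_pos hq _).le) (fun n => ?_)
    (summable_geometric_of_lt_one hq.le hq1)
  rw [← Real.rpow_natCast q n]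
  refine Real.rpow_le_rpow_of_exponent_ge hq hq1.le ?_
  have h1 : (1 : ℝ) ≤ k := by exact_mod_cast hk
  -- With `k ≥ 1` this bounds the exponent below by `n`, so a geometric series dominates.
  have h2 : (n : ℝ) ≤ ((n : ℝ) + 1 / 2) ^ 2 := by nlinarith [sq_nonneg (n : ℝ)]
  nlinarith [sq_nonneg ((n : ℝ) + 1 / 2)]

/-- The weights `(L₀, L̄₀)` of the symmetrized monomials. -/
def weight (k : ℕ) (x : (Chirality → ℕ) × ((Chirality × ℕ+) →₀ ℕ)) : ℝ × ℝ :=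
  ((k : ℝ) * ((x.1 .left : ℝ) + 1 / 2) ^ 2 + (level .left x.2 : ℝ),
    (k : ℝ) * ((x.1 .right : ℝ) + 1 / 2) ^ 2 + (level .right x.2 : ℝ))

theorem hasSum_theta_mul_theta {k : ℕ} (hk : 0 < k) {q : ℝ} (hq : 0 < q) (hq1 : q < 1) :
    HasSum (fun p : Chirality → ℕ => q ^ ((k : ℝ) * ((p .left : ℝ) + 1 / 2) ^ 2) *
        q ^ ((k : ℝ) * ((p .right : ℝ) + 1 / 2) ^ 2))
      ((∑' n : ℕ, q ^ ((k : ℝ) * ((n : ℝ) + 1 / 2) ^ 2)) *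
        ∑' n : ℕ, q ^ ((k : ℝ) * ((n : ℝ) + 1 / 2) ^ 2)) := by
  have hθ := summable_theta hk hq hq1
  have hθ0 : ∀ n : ℕ, 0 ≤ q ^ ((k : ℝ) * ((n : ℝ) + 1 / 2) ^ 2) :=
    fun n => (Real.rpow_pos_of_pos hq _).le
  have hθ2 := hθ.hasSum.mul hθ.hasSum (hθ.mul_of_nonneg hθ hθ0 hθ0)
  exact (pairEquiv ℕ).symm.hasSum_iff.2 hθ2

theorem hasSum_level {q : ℝ} (hq : 0 < q) (hq1 : q < 1) :
    HasSum (fun d : (Chirality × ℕ+) →₀ ℕ => q ^ (level .left d + level .right d))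
      ((∏' n : ℕ, (1 - q ^ (n + 1))) ^ 2)⁻¹ := by
  obtain ⟨hE0, hE⟩ := hasProd_one_sub_pow hq hq1
  have hD := hasSum_finsupp_prod_pow (a := fun x : Chirality × ℕ+ => q ^ (x.2 : ℕ))
    (fun x => pow_nonneg hq.le _) (fun x => pow_lt_one₀ hq.le hq1 x.2.pos.ne') hE
    (pow_ne_zero 2 hE0)
  simpa only [prod_pow_eq_zpow_level hq] using hD

/-- The weights split into a part from the site and a part from the oscillators, so the sum
factorizes. The two shifts by `1/24` supply the fractional powers in `eta q ^ 2`. -/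
theorem hasSum_weight {k : ℕ} (hk : 0 < k) {q : ℝ} (hq : 0 < q) (hq1 : q < 1) :
    HasSum (fun x => q ^ ((weight k x).1 - 1 / 24) * q ^ ((weight k x).2 - 1 / 24))
      (chiStar k q ^ 2) := by
  have hP := hasSum_theta_mul_theta hk hq hq1
  have hD := hasSum_level hq hq1
  have hPD := hP.mul hD (hP.summable.mul_of_nonneg hD.summable
    (fun p => mul_nonneg (Real.rpow_pos_of_pos hq _).le (Real.rpow_pos_of_pos hq _).le)
    (fun d => (zpow_pos hq _).le))
  have hfin := hPD.mul_left ((q ^ (1 / 24 : ℝ))⁻¹ ^ 2)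
  have hη : q ^ (1 / 24 : ℝ) ≠ 0 := (Real.rpow_pos_of_pos hq _).ne'
  have hval : chiStar k q ^ 2 = (q ^ (1 / 24 : ℝ))⁻¹ ^ 2 *
      ((∑' n : ℕ, q ^ ((k : ℝ) * ((n : ℝ) + 1 / 2) ^ 2)) *
        (∑' n : ℕ, q ^ ((k : ℝ) * ((n : ℝ) + 1 / 2) ^ 2)) *
          ((∏' n : ℕ, (1 - q ^ (n + 1))) ^ 2)⁻¹) := by
    rw [chiStar, tsum_div_const, eta]
    generalize (∑' n : ℕ, q ^ ((k : ℝ) * ((n : ℝ) + 1 / 2) ^ 2)) = Θ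
    field_simp
  rw [hval]
  refine (congrArg (HasSum · _) (funext fun x => ?_)).mpr hfin
  have hz : q ^ (level .left x.2 + level .right x.2) =
      q ^ (level .left x.2 : ℝ) * q ^ (level .right x.2 : ℝ) := by
    rw [← Real.rpow_add hq, ← Real.rpow_intCast]
    push_cast
    rfl
  simp only [hz, weight, Real.rpow_sub hq, Real.rpow_add hq]
  field_simp

theorem isTrace_symSpace {k : ℕ} (hk : 0 < k) (χ : Signs →* ℤˣ) {q : ℝ} (hq : 0 < q)
    (hq1 : q < 1) : IsTrace k (symSpace k χ) q (chiStar k q ^ 2) := by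
  rw [symSpace_eq_span]
  refine isTrace_span (linearIndependent_eigenvector hk χ) (w := weight k) (fun x => ?_)
    (fun x => ?_) hq (hasSum_weight hk hq hq1)
  · rw [eigenvector, vir0_sym_monomial hk]
    simp [weight]
  · rw [eigenvector, vir0_sym_monomial hk]
    simp [weight]

end Z2Orbifold

end

theorem proposition4 (k : ℕ) (hk : 0 < k) :
    generated k (ket 1 0 + ket (-1) 0 + (ket 0 k + ket 0 (-k))) = Hv k ∧
    generated k (ket 1 0 + ket (-1) 0 - (ket 0 k + ket 0 (-k))) = Hb k ∧
    (∀ q : ℝ, 0 < q → q < 1 →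
      IsTrace k (Hv k) q (chiStar k q ^ 2) ∧ IsTrace k (Hb k) q (chiStar k q ^ 2)) := by
  refine ⟨generated_vacuum hk, generated_antivacuum hk, fun q hq hq1 => ?_⟩
  rw [Hv_eq_symSpace, Hb_eq_symSpace]
  exact ⟨isTrace_symSpace hk _ hq hq1, isTrace_symSpace hk _ hq hq1⟩
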